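/- For $v\in[0,1]$ let $\rho_v=v\,|\mathrm{GHZ}_3\rangle\langle\mathrm{GHZ}_3|+(1-v)\,\mathbb 1/8$ with $|\mathrm{GHZ}_3\rangle=(|000\rangle+|111\rangle)/\sqrt2$. Let each of three parties hold one qubit of $\rho_v$ and be allowed a set of projective measurements, the one with Bloch vector $\vec u$ (a unit vector) having outcomes $a=\pm1$ and projectors $\tfrac12(\mathbb 1+a\,\vec u\cdot\vec\sigma)$. The nonlocality threshold for this set is the supremum of the $v\in[0,1]$ for which the resulting behaviour $p(abc|xyz)$ (given by the Born rule) has a local hidden variable model, i.e. $p(abc|xyz)=\int P(a|x,\lambda)Q(b|y,\lambda)R(c|z,\lambda)\,d\mu(\lambda)$ for a probability measure $\mu$ and response probabilities $P,Q,R$. Let $v_{16}$ be the threshold for the $16$ measurements with Bloch vectors $(\cos\frac{(x-1)\pi}{16},\sin\frac{(x-1)\pi}{16},0)$, $x=1,\dots,16$, and let $v_{XY}$ be the threshold for all projective measurements with Bloch vector in the XY plane. Then $$v_{16}=\Big(\tfrac12+\tfrac{\sqrt2}{3}-\tfrac{120\cos\frac\pi8+56\sin\frac\pi8}{137}+\tfrac{11960704\cos\frac\pi{16}-11459008\sin\frac\pi{16}}{9508049}+\tfrac{15419776\cos\frac{3\pi}{16}-5453760\sin\frac{3\pi}{16}}{9508049}\Big)^{-1}\approx0.49160$$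 and $$v_{XY}\ \ge\ \cos\!\left(\tfrac{\pi}{32}\right)^3 v_{16}\approx0.48453,$$ where each $\approx$ means equality up to an error of at most $5\cdot10^{-6}$. -/

import Mathlib

open MeasureTheory
open scoped Kronecker

noncomputable section

namespace GHZ

/-- Index set of the computational basis of three qubits. -/
abbrev Qubits3 : Type := Fin 2 × Fin 2 × Fin 2

/-- The Pauli matrices. -/
def pauliX : Matrix (Fin 2) (Fin 2) ℂ := !![0, 1; 1, 0]

def pauliY : Matrix (Fin 2) (Fin 2) ℂ := !![0, -Complex.I; Complex.I, 0]

def pauliZ : Matrix (Fin 2) (Fin 2) ℂ := !![1, 0; 0, -1]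

/-- The qubit observable `u · σ` attached to a Bloch vector `u`. -/
def observable (u : EuclideanSpace ℝ (Fin 3)) : Matrix (Fin 2) (Fin 2) ℂ :=
  (u 0 : ℂ) • pauliX + (u 1 : ℂ) • pauliY + (u 2 : ℂ) • pauliZ

/-- The projector `(1 + a (u · σ)) / 2` on the outcome `a = ±1` of the projective measurement
with Bloch vector `u` (a unit vector). -/
def projector (u : EuclideanSpace ℝ (Fin 3)) (a : ℤˣ) : Matrix (Fin 2) (Fin 2) ℂ :=
  (1 / 2 : ℂ) • (1 + (((a : ℤ) : ℂ)) • observable u)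

/-- The vector `(|000⟩ + |111⟩) / √2`. -/
def ghzVector : Qubits3 → ℂ := fun i =>
  if i = (0, 0, 0) ∨ i = (1, 1, 1) then ((1 / Real.sqrt 2 : ℝ) : ℂ) else 0

/-- The tripartite GHZ state with visibility `v`: `v |GHZ⟩⟨GHZ| + (1 - v) 1 / 8`. -/
def ghzState (v : ℝ) : Matrix Qubits3 Qubits3 ℂ :=
  (v : ℂ) • Matrix.vecMulVec ghzVector (star ghzVector) + ((1 - v) / 8 : ℂ) • 1

/-- A tripartite behaviour `p(a b c | x y z)` with inputs in `X` and outputs `±1`. -/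
abbrev Behaviour (X : Type) : Type := X → X → X → ℤˣ → ℤˣ → ℤˣ → ℝ

/-- The behaviour obtained by the Born rule when each of the three parties measures its qubit of
the GHZ state with visibility `v`, the input `x` standing for the projective measurement with
Bloch vector `u x`. -/
def ghzBehaviour {X : Type} (u : X → EuclideanSpace ℝ (Fin 3)) (v : ℝ) : Behaviour X :=
  fun x y z a b c =>
    (Matrix.trace
      ((projector (u x) a ⊗ₖ (projector (u y) b ⊗ₖ projector (u z) c)) * ghzState v)).re

/-- `P x a l` is the probability that a party outputs `a` on the input `x` when the value of the
hidden variable is `l`. -/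
structure IsResponse {X Λ : Type} [MeasurableSpace Λ] (P : X → ℤˣ → Λ → ℝ) : Prop where
  measurable : ∀ x a, Measurable (P x a)
  nonneg : ∀ x a l, 0 ≤ P x a l
  sum_eq_one : ∀ x l, ∑ a : ℤˣ, P x a l = 1

/-- A behaviour is local if it has a local hidden variable model. -/
def IsLocal {X : Type} (p : Behaviour X) : Prop :=
  ∃ (Λ : Type) (_ : MeasurableSpace Λ) (μ : Measure Λ) (P Q R : X → ℤˣ → Λ → ℝ),
    IsProbabilityMeasure μ ∧ IsResponse P ∧ IsResponse Q ∧ IsResponse R ∧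
      ∀ x y z a b c, p x y z a b c = ∫ l, P x a l * Q y b l * R z c l ∂μ

/-- The nonlocality threshold of the GHZ state for the family `u` of projective measurements,
available to each of the three parties: the largest visibility with a local behaviour. -/
def threshold {X : Type} (u : X → EuclideanSpace ℝ (Fin 3)) : ℝ :=
  sSup {v : ℝ | 0 ≤ v ∧ v ≤ 1 ∧ IsLocal (ghzBehaviour u v)}

/-- The `m` planar measurements whose Bloch vectors, together with their opposites, form a regular
`2m`-gon in the XY plane. -/
def polygon (m : ℕ) : Fin m → EuclideanSpace ℝ (Fin 3) := fun x =>
  !₂[Real.cos ((x : ℕ) * Real.pi / m), Real.sin ((x : ℕ) * Real.pi / m), 0]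

/-- All unit Bloch vectors in the XY plane. -/
def planeXY : {u : EuclideanSpace ℝ (Fin 3) // ‖u‖ = 1 ∧ u 2 = 0} → EuclideanSpace ℝ (Fin 3) :=
  fun u => u.1

/-- The nonlocality threshold `v₁₆` for the 16 measurements of the regular polygon. -/
def v16 : ℝ := threshold (polygon 16)

/-- The nonlocality threshold `v_XY` for all projective measurements in the XY plane. -/
def vXY : ℝ := threshold planeXY

end GHZ

end

noncomputable section

namespace GHZ

/-! For measurements in the XY plane the GHZ behaviour has vanishing one- and two-party correlators,
and its three-party correlator is `v * cos (θ x + θ y + θ z)`. A local model of the behaviour is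
therefore the same as bounded response functions with these moments (`IsLocal.hasModel`,
`HasModel.isLocal`). Adding the opposite directions, with opposite responses, turns the 16 inputs
into `ZMod 32` and the responses into antiperiodic functions, and everything depends on `x + y + z`
only. The threshold is found by linear programming duality.

Primal side: two square waves and a third wave, rotated at random with total rotation zero, produce
a correlator that is an even antiperiodic function of `x + y + z`. Odd multiplications of `ZMod 32`
give eight such functions, which span the eight-dimensional space of even antiperiodic functions. So
the cosine is a unique combination of them; dividing by the sum of the absolute values of its
weights, which is `invThreshold`, gives a model of visibility `invThreshold⁻¹`
(`hasModel_of_weights`, `sum_weight_mul_waveCorr`, `sum_abs_weight`).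

Dual side: `bell` is the functional taking the same absolute value on all eight functions, with the
signs of the weights. Its value on the cosine shows optimality as soon as its maximum over all sign
strategies is known (`bellValue_le`). By pigeonhole two of the three strategies have small additive
energy, or two have large energy. In the first case Cauchy-Schwarz and a spectral bound suffice. In
the second, both strategies are rotations of 56 listed ones, and each pair is checked with the best
third response.

For the whole plane, a unit vector shrunk by `cos (π / 32)` lies in the 32-gon, so responses extend
by convex combination; trilinearity costs the cube of this factor (`HasModel.plane`). -/

/-- The unit Bloch vector of angle `t` in the XY plane. -/
def planar (t : ℝ) : EuclideanSpace ℝ (Fin 3) := !₂[Real.cos t, Real.sin t, 0]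

/-! ### Born rule and reduction to correlators -/

lemma projector_planar (t : ℝ) (a : ℤˣ) :
    projector (planar t) a = !![1 / 2, (a : ℤ) * (Real.cos t - Real.sin t * Complex.I) / 2;
      (a : ℤ) * (Real.cos t + Real.sin t * Complex.I) / 2, 1 / 2] := by
  ext i j
  fin_cases i <;> fin_cases j <;>
    simp [projector, observable, planar, pauliX, pauliY, pauliZ] <;> ring

lemma ghzBehaviour_planar {X : Type} (θ : X → ℝ) (v : ℝ) (x y z : X) (a b c : ℤˣ) :
    ghzBehaviour (fun x => planar (θ x)) v x y z a b c =
      (1 + (a : ℤ) * (b : ℤ) * (c : ℤ) * (v * Real.cos (θ x + θ y + θ z))) / 8 := by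
  have hs : ((√2 : ℝ) : ℂ)⁻¹ * ((√2 : ℝ) : ℂ)⁻¹ = 1 / 2 := by
    rw [← mul_inv, ← Complex.ofReal_mul, Real.mul_self_sqrt (by norm_num)]; norm_num
  have key : Matrix.trace ((projector (planar (θ x)) a ⊗ₖ
      (projector (planar (θ y)) b ⊗ₖ projector (planar (θ z)) c)) * ghzState v) =
      (((1 + (a : ℤ) * (b : ℤ) * (c : ℤ) * (v * Real.cos (θ x + θ y + θ z))) / 8 : ℝ) : ℂ) := by
    simp only [projector_planar]
    simp [Matrix.trace, Matrix.mul_apply, Fintype.sum_prod_type, ghzState, ghzVector,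
      Matrix.vecMulVec_apply, Matrix.one_apply, hs, Real.cos_add, Real.sin_add]
    ring_nf
    simp only [Complex.I_sq]
    ring_nf
  unfold ghzBehaviour
  rw [key, Complex.ofReal_re]

/-- A local model of the three-party correlators `T`, in terms of the expectation values of the
responses, whose one- and two-party correlators vanish. -/
def HasModel {X : Type} (T : X → X → X → ℝ) : Prop :=
  ∃ (Λ : Type) (_ : MeasurableSpace Λ) (μ : Measure Λ) (E F G : X → Λ → ℝ),
    IsProbabilityMeasure μ ∧ (∀ x, Measurable (E x)) ∧ (∀ x, Measurable (F x)) ∧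
      (∀ x, Measurable (G x)) ∧ (∀ x l, |E x l| ≤ 1) ∧ (∀ x l, |F x l| ≤ 1) ∧
      (∀ x l, |G x l| ≤ 1) ∧
      (∀ x, ∫ l, E x l ∂μ = 0) ∧ (∀ x, ∫ l, F x l ∂μ = 0) ∧ (∀ x, ∫ l, G x l ∂μ = 0) ∧
      (∀ x y, ∫ l, E x l * F y l ∂μ = 0) ∧ (∀ x z, ∫ l, E x l * G z l ∂μ = 0) ∧
      (∀ y z, ∫ l, F y l * G z l ∂μ = 0) ∧
      ∀ x y z, ∫ l, E x l * F y l * G z l ∂μ = T x y z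

lemma integrable_of_abs_le_one {Λ : Type} [MeasurableSpace Λ] {μ : Measure Λ}
    [IsProbabilityMeasure μ] {f : Λ → ℝ} (hf : Measurable f) (h : ∀ l, |f l| ≤ 1) :
    Integrable f μ :=
  Integrable.of_bound hf.aestronglyMeasurable 1 (ae_of_all _ h)

lemma abs_mul_le_one {a b : ℝ} (ha : |a| ≤ 1) (hb : |b| ≤ 1) : |a * b| ≤ 1 := by
  rw [abs_mul]; exact mul_le_one₀ ha (abs_nonneg _) hb

lemma sum_units_int {M : Type*} [AddCommMonoid M] (f : ℤˣ → M) : ∑ a : ℤˣ, f a = f 1 + f (-1) := by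
  rw [show (Finset.univ : Finset ℤˣ) = {1, -1} from rfl, Finset.sum_pair (by decide)]

lemma IsResponse.le_one {X Λ : Type} [MeasurableSpace Λ] {P : X → ℤˣ → Λ → ℝ}
    (hP : IsResponse P) (x : X) (a : ℤˣ) (l : Λ) : P x a l ≤ 1 := by
  rw [← hP.sum_eq_one x l]
  exact Finset.single_le_sum (f := fun a => P x a l) (fun a _ => hP.nonneg x a l)
    (Finset.mem_univ a)

lemma IsResponse.abs_le_one {X Λ : Type} [MeasurableSpace Λ] {P : X → ℤˣ → Λ → ℝ}
    (hP : IsResponse P) (x : X) (a : ℤˣ) (l : Λ) : |P x a l| ≤ 1 :=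
  abs_le.2 ⟨by linarith [hP.nonneg x a l], hP.le_one x a l⟩

lemma IsResponse.abs_sub_le_one {X Λ : Type} [MeasurableSpace Λ] {P : X → ℤˣ → Λ → ℝ}
    (hP : IsResponse P) (x : X) (l : Λ) : |P x 1 l - P x (-1) l| ≤ 1 :=
  abs_le.2 ⟨by linarith [hP.nonneg x 1 l, hP.le_one x (-1) l],
    by linarith [hP.nonneg x (-1) l, hP.le_one x 1 l]⟩

lemma isResponse_of_abs_le_one {X Λ : Type} [MeasurableSpace Λ] {E : X → Λ → ℝ}
    (hm : ∀ x, Measurable (E x)) (h : ∀ x l, |E x l| ≤ 1) :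
    IsResponse (fun x (a : ℤˣ) l => (1 + ((a : ℤ) : ℝ) * E x l) / 2) where
  measurable x a := ((measurable_const.add ((hm x).const_mul _)).div_const _)
  nonneg x a l := by
    have := abs_le.1 (h x l)
    rcases Int.units_eq_one_or a with rfl | rfl <;> simp <;> linarith
  sum_eq_one x l := by rw [sum_units_int]; simp; ring

/-- The responses `(1 + a E) / 2` have expectation `E`. Expanding the product of three of them gives
eight moments, of which only the constant and the triple one survive integration. -/
lemma HasModel.isLocal {X : Type} {θ : X → ℝ} {v : ℝ}
    (h : HasModel fun x y z => v * Real.cos (θ x + θ y + θ z)) :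
    IsLocal (ghzBehaviour (fun x => planar (θ x)) v) := by
  obtain ⟨Λ, _, μ, E, F, G, hμ, mE, mF, mG, bE, bF, bG, hE, hF, hG, hEF, hEG, hFG, hT⟩ := h
  refine ⟨Λ, _, μ, _, _, _, hμ, isResponse_of_abs_le_one mE bE, isResponse_of_abs_le_one mF bF,
    isResponse_of_abs_le_one mG bG, fun x y z a b c => ?_⟩
  have iE := integrable_of_abs_le_one (μ := μ) (mE x) (bE x)
  have iF := integrable_of_abs_le_one (μ := μ) (mF y) (bF y)
  have iG := integrable_of_abs_le_one (μ := μ) (mG z) (bG z)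
  have iEF := integrable_of_abs_le_one (μ := μ) ((mE x).mul (mF y))
    fun l => abs_mul_le_one (bE x l) (bF y l)
  have iEG := integrable_of_abs_le_one (μ := μ) ((mE x).mul (mG z))
    fun l => abs_mul_le_one (bE x l) (bG z l)
  have iFG := integrable_of_abs_le_one (μ := μ) ((mF y).mul (mG z))
    fun l => abs_mul_le_one (bF y l) (bG z l)
  have iEFG := integrable_of_abs_le_one (μ := μ) (((mE x).mul (mF y)).mul (mG z))
    fun l => abs_mul_le_one (abs_mul_le_one (bE x l) (bF y l)) (bG z l)
  set α : ℝ := ((a : ℤ) : ℝ)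
  set β : ℝ := ((b : ℤ) : ℝ)
  set γ : ℝ := ((c : ℤ) : ℝ)
  have expand : ∀ l, (1 + α * E x l) / 2 * ((1 + β * F y l) / 2) * ((1 + γ * G z l) / 2) =
      1 / 8 + α / 8 * E x l + β / 8 * F y l + γ / 8 * G z l + α * β / 8 * (E x l * F y l) +
        α * γ / 8 * (E x l * G z l) + β * γ / 8 * (F y l * G z l) +
        α * β * γ / 8 * (E x l * F y l * G z l) := fun l => by ring
  rw [ghzBehaviour_planar, integral_congr_ae (ae_of_all _ expand), integral_add, integral_add,
    integral_add, integral_add, integral_add, integral_add, integral_add]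
  · simp only [integral_const_mul, hE, hF, hG, hEF, hEG, hFG, hT, integral_const, probReal_univ,
      one_smul]
    ring
  all_goals
    repeat' apply Integrable.add
  all_goals
    first
    | exact integrable_const _
    | exact iEFG.const_mul _
    | exact iFG.const_mul _
    | exact iEG.const_mul _
    | exact iEF.const_mul _
    | exact iE.const_mul _
    | exact iF.const_mul _
    | exact iG.const_mul _

/-- Integrating the model against test functions of the outcomes, each either `1` or the outcome
itself, reads off every moment of the differences `P x 1 - P x (-1)`. -/
lemma IsLocal.hasModel {X : Type} {θ : X → ℝ} {v : ℝ}
    (h : IsLocal (ghzBehaviour (fun x => planar (θ x)) v)) :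
    HasModel fun x y z => v * Real.cos (θ x + θ y + θ z) := by
  obtain ⟨Λ, _, μ, P, Q, R, hμ, hP, hQ, hR, h⟩ := h
  have key : ∀ (x y z : X) (χ ψ ω : ℤˣ → ℝ),
      ∫ l, (∑ a, χ a * P x a l) * (∑ b, ψ b * Q y b l) * (∑ c, ω c * R z c l) ∂μ =
        ∑ a, ∑ b, ∑ c, χ a * ψ b * ω c *
          ((1 + (a : ℤ) * (b : ℤ) * (c : ℤ) * (v * Real.cos (θ x + θ y + θ z))) / 8) := by
    intro x y z χ ψ ω
    have hi : ∀ a b c, Integrable (fun l => χ a * ψ b * ω c * (P x a l * Q y b l * R z c l)) μ :=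
      fun a b c => (integrable_of_abs_le_one
        (((hP.measurable x a).mul (hQ.measurable y b)).mul (hR.measurable z c)) fun l =>
          abs_mul_le_one (abs_mul_le_one (hP.abs_le_one x a l) (hQ.abs_le_one y b l))
            (hR.abs_le_one z c l)).const_mul _
    have expand : ∀ l, (∑ a, χ a * P x a l) * (∑ b, ψ b * Q y b l) * (∑ c, ω c * R z c l) =
        ∑ a, ∑ b, ∑ c, χ a * ψ b * ω c * (P x a l * Q y b l * R z c l) := fun l => by
      simp only [sum_units_int]; ring
    rw [integral_congr_ae (ae_of_all _ expand), integral_finsetSum _ fun a _ =>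
      integrable_finsetSum _ fun b _ => integrable_finsetSum _ fun c _ => hi a b c]
    refine Finset.sum_congr rfl fun a _ => ?_
    rw [integral_finsetSum _ fun b _ => integrable_finsetSum _ fun c _ => hi a b c]
    refine Finset.sum_congr rfl fun b _ => ?_
    rw [integral_finsetSum _ fun c _ => hi a b c]
    refine Finset.sum_congr rfl fun c _ => ?_
    rw [integral_const_mul, ← h, ghzBehaviour_planar]
  have one (P : X → ℤˣ → Λ → ℝ) (hP : IsResponse P) (x : X) (l : Λ) :
      ∑ a, P x a l = 1 := hP.sum_eq_one x l
  have diff (P : X → ℤˣ → Λ → ℝ) (x : X) (l : Λ) :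
      ∑ a : ℤˣ, ((a : ℤ) : ℝ) * P x a l = P x 1 l - P x (-1) l := by
    rw [sum_units_int]; simp; ring
  refine ⟨Λ, _, μ, fun x l => P x 1 l - P x (-1) l, fun x l => Q x 1 l - Q x (-1) l,
    fun x l => R x 1 l - R x (-1) l, hμ, fun x => (hP.measurable x _).sub (hP.measurable x _),
    fun x => (hQ.measurable x _).sub (hQ.measurable x _),
    fun x => (hR.measurable x _).sub (hR.measurable x _), hP.abs_sub_le_one, hQ.abs_sub_le_one,
    hR.abs_sub_le_one, fun x => ?_, fun x => ?_, fun x => ?_, fun x y => ?_, fun x y => ?_,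
    fun x y => ?_, fun x y z => ?_⟩
  · have := key x x x (fun a => (a : ℤ)) 1 1
    simp only [Pi.one_apply, one_mul, one Q hQ, one R hR, diff, mul_one] at this
    rw [this]; simp; ring
  · have := key x x x 1 (fun a => (a : ℤ)) 1
    simp only [Pi.one_apply, one P hP, one R hR, diff, mul_one, one_mul] at this
    rw [this]; simp
  · have := key x x x 1 1 (fun a => (a : ℤ))
    simp only [Pi.one_apply, one P hP, one Q hQ, diff, mul_one, one_mul] at this
    rw [this]; simp
  · have := key x y x (fun a => (a : ℤ)) (fun a => (a : ℤ)) 1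
    simp only [Pi.one_apply, one R hR, diff, mul_one, one_mul] at this
    rw [this]; simp
  · have := key x x y (fun a => (a : ℤ)) 1 (fun a => (a : ℤ))
    simp only [Pi.one_apply, one Q hQ, diff, mul_one, one_mul] at this
    rw [this]; simp
  · have := key x x y 1 (fun a => (a : ℤ)) (fun a => (a : ℤ))
    simp only [Pi.one_apply, one P hP, diff, one_mul] at this
    rw [this]; simp; ring
  · have := key x y z (fun a => (a : ℤ)) (fun a => (a : ℤ)) (fun a => (a : ℤ))
    simp only [diff] at this
    rw [this]; simp; ring

/-! ### Kernel-friendly arithmetic on packed vectors -/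

/-- The number with base `T` digits `d 0, …, d (k - 1)`. -/
def pack (T k : ℕ) (d : ℕ → ℕ) : ℕ := ∑ z ∈ Finset.range k, d z * T ^ z

/-- The binary code of the rotation by one step of an antiperiodic sign sequence with code `n`. -/
def rot (n : ℕ) : ℕ := Nat.add (Nat.div n 2) (Nat.mul 32768 (Nat.sub 1 (Nat.mod n 2)))

/-- Whether `n` is at most each of the first `k` rotations of `m`. -/
def isMin (n : ℕ) : ℕ → ℕ → Bool :=
  Nat.rec (fun _ => true) fun _ ih m => cond (Nat.ble n m) (ih (rot m)) false

/-- The sum of the rotations of the packed vector `w`, with signs the binary digits of `n`. -/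
def sweep (T K S : ℕ) : ℕ → ℕ → ℕ → ℕ :=
  Nat.rec (fun _ _ => 0) fun _ ih n w => Nat.add
    (cond (Nat.beq (Nat.mod n 2) 1) w (Nat.sub S w))
    (ih (Nat.div n 2) (Nat.add (Nat.div w T) (Nat.mul (Nat.sub K (Nat.mod w T)) (Nat.pow T 15))))

/-- The sum of the values of `f` at the base `T` digits. -/
def digitSum (f : ℕ → ℕ) (T : ℕ) : ℕ → ℕ → ℕ :=
  Nat.rec (fun _ => 0) fun _ ih n => Nat.add (f (Nat.mod n T)) (ih (Nat.div n T))

def dist (a b : ℕ) : ℕ := Nat.add (Nat.sub a b) (Nat.sub b a)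

/-- The digit `2 b` is `1` plus the sign coded by the bit `b`: signs are stored with offset `1` to
stay natural numbers. -/
def packBits (T : ℕ) : ℕ → ℕ → ℕ :=
  Nat.rec (fun _ => 0) fun _ ih n =>
    Nat.add (Nat.mul 2 (Nat.mod n 2)) (Nat.mul T (ih (Nat.div n 2)))

/-- Raw recursors, `cond` and the named operations on `Nat` keep these checks directly reducible by
the kernel, with its fast arithmetic on literals. -/
def checkUpTo (p : ℕ → Bool) : ℕ → Bool := Nat.rec true fun k ih => cond (p k) ih false

def checkAll (p : ℕ → Bool) : List ℕ → Bool := List.rec true fun a _ ih => cond (p a) ih false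

lemma checkUpTo_spec {p : ℕ → Bool} {n : ℕ} (h : checkUpTo p n = true) :
    ∀ k < n, p k = true := by
  induction n with
  | zero => simp
  | succ n ih =>
    have h' : cond (p n) (checkUpTo p n) false = true := h
    cases hp : p n with
    | false => simp [hp] at h'
    | true =>
      intro k hk
      rcases Nat.lt_succ_iff_lt_or_eq.1 hk with hk | rfl
      · exact ih (by simpa [hp] using h') k hk
      · exact hp

lemma checkAll_spec {p : ℕ → Bool} {l : List ℕ} (h : checkAll p l = true) :
    ∀ k ∈ l, p k = true := by
  induction l with
  | nil => simp
  | cons a l ih =>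
    have h' : cond (p a) (checkAll p l) false = true := h
    cases hp : p a with
    | false => simp [hp] at h'
    | true =>
      intro k hk
      rcases List.mem_cons.1 hk with rfl | hk
      · exact hp
      · exact ih (by simpa [hp] using h') k hk

lemma pack_succ (T k : ℕ) (d : ℕ → ℕ) :
    pack T (k + 1) d = d 0 + T * pack T k (fun z => d (z + 1)) := by
  simp only [pack, Finset.sum_range_succ', pow_zero, mul_one, Finset.mul_sum]
  rw [add_comm]
  congr 1
  exact Finset.sum_congr rfl fun z _ => by ring

lemma pack_succ_mod {T k : ℕ} {d : ℕ → ℕ} (h : d 0 < T) : pack T (k + 1) d % T = d 0 := by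
  rw [pack_succ, Nat.add_mul_mod_self_left, Nat.mod_eq_of_lt h]

lemma pack_succ_div {T k : ℕ} {d : ℕ → ℕ} (h : d 0 < T) :
    pack T (k + 1) d / T = pack T k (fun z => d (z + 1)) := by
  rw [pack_succ, Nat.add_mul_div_left _ _ (by omega), Nat.div_eq_of_lt h, zero_add]

lemma pack_congr {T k : ℕ} {d e : ℕ → ℕ} (h : ∀ z < k, d z = e z) : pack T k d = pack T k e :=
  Finset.sum_congr rfl fun z hz => by rw [h z (Finset.mem_range.1 hz)]

lemma pack_add (T k : ℕ) (d e : ℕ → ℕ) :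
    pack T k d + pack T k e = pack T k (fun z => d z + e z) := by
  simp only [pack, ← Finset.sum_add_distrib, add_mul]

lemma pack_const_sub {T k K : ℕ} {d : ℕ → ℕ} (h : ∀ z, d z ≤ K) :
    pack T k (fun _ => K) - pack T k d = pack T k (fun z => K - d z) := by
  have : pack T k d + pack T k (fun z => K - d z) = pack T k (fun _ => K) := by
    rw [pack_add]; exact pack_congr fun z _ => by have := h z; omega
  omega

lemma digitSum_pack (f : ℕ → ℕ) {T : ℕ} (k : ℕ) {d : ℕ → ℕ} (h : ∀ z, d z < T) :
    digitSum f T k (pack T k d) = ∑ z ∈ Finset.range k, f (d z) := by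
  induction k generalizing d with
  | zero => rfl
  | succ k ih =>
    have : digitSum f T (k + 1) (pack T (k + 1) d) = f (pack T (k + 1) d % T) +
      digitSum f T k (pack T (k + 1) d / T) := rfl
    rw [this, pack_succ_mod (h 0), pack_succ_div (h 0), ih fun z => h _, Finset.sum_range_succ',
      add_comm]

lemma packBits_pack {T : ℕ} (k : ℕ) {b : ℕ → ℕ} (h : ∀ z, b z < 2) :
    packBits T k (pack 2 k b) = pack T k (fun z => 2 * b z) := by
  induction k generalizing b with
  | zero => rfl
  | succ k ih =>
    have : packBits T (k + 1) (pack 2 (k + 1) b) = 2 * (pack 2 (k + 1) b % 2) +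
      T * packBits T k (pack 2 (k + 1) b / 2) := rfl
    rw [this, pack_succ_mod (h 0), pack_succ_div (h 0), ih fun z => h _, pack_succ]

/-- The digits encode an antiperiodic function with an offset, so a change of sign is the complement
`K - u`. One subtraction negates a whole vector, and one addition accumulates all sixteen entries.
-/
lemma sweep_pack {T K : ℕ} (hT : K < T) (k : ℕ) {b u : ℕ → ℕ} (hb : ∀ z, b z < 2)
    (hu : ∀ z, u z ≤ K) (hu' : ∀ z, u (z + 16) = K - u z) :
    sweep T K (pack T 16 fun _ => K) k (pack 2 k b) (pack T 16 u) =
      pack T 16 fun z => ∑ i ∈ Finset.range k, if b i = 1 then u (z + i) else K - u (z + i) := by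
  induction k generalizing b u with
  | zero => simp [sweep, pack]
  | succ k ih =>
    have : sweep T K (pack T 16 fun _ => K) (k + 1) (pack 2 (k + 1) b) (pack T 16 u) =
      (cond (Nat.beq (pack 2 (k + 1) b % 2) 1) (pack T 16 u)
        ((pack T 16 fun _ => K) - pack T 16 u)) +
      sweep T K (pack T 16 fun _ => K) k (pack 2 (k + 1) b / 2)
        (pack T 16 u / T + (K - pack T 16 u % T) * T ^ 15) := rfl
    -- Rotation drops the lowest digit `u 0` and puts its complement, which is `u 16`, on top.
    have next : pack T 16 u / T + (K - pack T 16 u % T) * T ^ 15 =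
        pack T 16 fun z => u (z + 1) := by
      have h0 : u 0 < T := (hu 0).trans_lt hT
      rw [pack_succ_div h0, pack_succ_mod h0, ← hu' 0]
      simp [pack, Finset.sum_range_succ]
    rw [this, pack_succ_mod (hb 0), pack_succ_div (hb 0), next, ih (fun z => hb _) (fun z => hu _)
      (fun z => by rw [← hu', add_right_comm]), pack_const_sub hu]
    have : (cond (Nat.beq (b 0) 1) (pack T 16 u) (pack T 16 fun z => K - u z)) =
        pack T 16 fun z => if b 0 = 1 then u z else K - u z := by
      by_cases h : b 0 = 1
      · simp [h]
      · rw [show Nat.beq (b 0) 1 = false from by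
          rw [Bool.eq_false_iff]; exact fun h' => h (Nat.eq_of_beq_eq_true h')]
        simp [h]
    rw [this, pack_add]
    refine pack_congr fun z _ => ?_
    rw [Finset.sum_range_succ', add_comm]
    simp [add_assoc]

lemma pack_rot {b : ℕ → ℕ} (hb : ∀ z, b z < 2) (hb' : b 16 = 1 - b 0) :
    rot (pack 2 16 b) = pack 2 16 fun z => b (z + 1) := by
  have : rot (pack 2 16 b) = pack 2 16 b / 2 + 32768 * (1 - pack 2 16 b % 2) := rfl
  rw [this, pack_succ_mod (hb 0), pack_succ_div (hb 0), ← hb']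
  simp [pack, Finset.sum_range_succ, mul_comm]

lemma isMin_pack {n : ℕ} (k : ℕ) {b : ℕ → ℕ} (hb : ∀ z, b z < 2)
    (hb' : ∀ z, b (z + 16) = 1 - b z) (h : ∀ j, n ≤ pack 2 16 fun z => b (z + j)) :
    isMin n k (pack 2 16 b) = true := by
  induction k generalizing b with
  | zero => rfl
  | succ k ih =>
    have : isMin n (k + 1) (pack 2 16 b) =
      cond (Nat.ble n (pack 2 16 b)) (isMin n k (rot (pack 2 16 b))) false := rfl
    have h0 : Nat.ble n (pack 2 16 b) = true := Nat.ble_eq_true_of_le (h 0)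
    rw [this, h0, pack_rot hb (by simpa using hb' 0)]
    exact ih (fun z => hb _) (fun z => by rw [← hb', add_right_comm])
      fun j => by simpa [add_right_comm, add_assoc] using h (j + 1)

lemma cast_dist (a b : ℕ) : ((dist a b : ℕ) : ℤ) = |(a : ℤ) - b| := by
  have : dist a b = (a - b) + (b - a) := rfl
  rw [this]
  rcases le_total a b with h | h
  · rw [abs_of_nonpos (by omega)]; omega
  · rw [abs_of_nonneg (by omega)]; omega

/-! ### Antiperiodic sequences on `ZMod 32` -/

/-- The coefficients of the Bell inequality, as an even antiperiodic function, scaled by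
`6 * 137 * 9508049`. -/
def bell : ZMod 32 → ℤ :=
  ![3907808139, 4915849344, -3422897640, 6337527936, 2605205426, -2241495360, -1597352232,
    -4709652288, 0, 4709652288, 1597352232, 2241495360, -2605205426, -6337527936, 3422897640,
    -4915849344, -3907808139, -4915849344, 3422897640, -6337527936, -2605205426, 2241495360,
    1597352232, 4709652288, 0, -4709652288, -1597352232, -2241495360, 2605205426, 6337527936,
    -3422897640, 4915849344]

lemma bell_add : ∀ s, bell (s + 16) = -bell s := by decide

lemma abs_bell_le : ∀ s, |bell s| ≤ 2 ^ 33 := by decide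

/-- Antiperiodic sequences of signs: the deterministic responses to the measurements of the regular
32-gon, opposite directions having opposite responses. -/
structure IsSign (A : ZMod 32 → ℤ) : Prop where
  add_eq : ∀ x, A (x + 16) = -A x
  eq_or : ∀ x, A x = 1 ∨ A x = -1

lemma IsSign.shift {A : ZMod 32 → ℤ} (hA : IsSign A) (j : ZMod 32) :
    IsSign (fun x => A (x + j)) :=
  ⟨fun x => by rw [← hA.add_eq, add_right_comm], fun x => hA.eq_or _⟩

lemma sum_zmod_eq_sum_range {M : Type*} [AddCommMonoid M] (g : ZMod 32 → M) :
    ∑ x, g x = ∑ i ∈ Finset.range 32, g (i : ZMod 32) := by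
  rw [Finset.sum_range fun i => g (i : ZMod 32)]
  exact Finset.sum_congr rfl fun x _ => congrArg g (ZMod.natCast_zmod_val (n := 32) x).symm

lemma sum_zmod_eq_two_mul {R : Type*} [Semiring R] {g : ZMod 32 → R}
    (h : ∀ x, g (x + 16) = g x) :
    ∑ x, g x = 2 * ∑ i ∈ Finset.range 16, g (i : ZMod 32) := by
  rw [sum_zmod_eq_sum_range, Finset.sum_range_add _ 16 16, two_mul]
  congr 1
  exact Finset.sum_congr rfl fun i _ => by push_cast; rw [add_comm]; exact h _

/-- The autocorrelation of a sequence. -/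
def autocorr (A : ZMod 32 → ℤ) (j : ZMod 32) : ℤ := ∑ x, A x * A (x + j)

/-- The additive energy of a sequence. -/
def energy (A : ZMod 32 → ℤ) : ℤ := ∑ j, autocorr A j ^ 2

/-- The value of the Bell functional at a product strategy. -/
def bellValue (A B C : ZMod 32 → ℤ) : ℤ :=
  ∑ x, ∑ y, ∑ z, bell (x + y + z) * A x * B y * C z

lemma bellValue_swap (A B C : ZMod 32 → ℤ) : bellValue A B C = bellValue B A C := by
  unfold bellValue
  rw [Finset.sum_comm]
  exact Finset.sum_congr rfl fun x _ => Finset.sum_congr rfl fun y _ =>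
    Finset.sum_congr rfl fun z _ => by rw [add_comm y x]; ring

lemma bellValue_rotate (A B C : ZMod 32 → ℤ) : bellValue A B C = bellValue B C A := by
  unfold bellValue
  rw [Finset.sum_comm]
  refine Finset.sum_congr rfl fun x _ => ?_
  rw [Finset.sum_comm]
  exact Finset.sum_congr rfl fun y _ => Finset.sum_congr rfl fun z _ => by
    rw [show z + x + y = x + y + z by ring]; ring

lemma bellValue_shift (A B C : ZMod 32 → ℤ) (i j : ZMod 32) :
    bellValue (fun x => A (x + i)) (fun y => B (y + j)) (fun z => C (z - i - j)) =
      bellValue A B C := by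
  symm
  unfold bellValue
  rw [← Equiv.sum_comp (Equiv.addRight i)]
  refine Finset.sum_congr rfl fun x _ => ?_
  rw [← Equiv.sum_comp (Equiv.addRight j)]
  refine Finset.sum_congr rfl fun y _ => ?_
  rw [← Equiv.sum_comp (Equiv.addRight (-i - j))]
  refine Finset.sum_congr rfl fun z _ => ?_
  simp only [Equiv.coe_addRight]
  rw [show x + i + (y + j) + (z + (-i - j)) = x + y + z by ring,
    show z + (-i - j) = z - i - j by ring]

/-- The convolution of two sequences. -/
def conv (A B : ZMod 32 → ℤ) (s : ZMod 32) : ℤ := ∑ x, A x * B (s - x)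

/-- Both sides sum `A x * A x' * B y * B y'` over `x + y = x' + y'`; the right side groups the terms
by the common difference `j = x' - x = y - y'`. -/
lemma sum_conv_sq (A B : ZMod 32 → ℤ) :
    ∑ s, conv A B s ^ 2 = ∑ j, autocorr A j * autocorr B j := by
  calc ∑ s, conv A B s ^ 2
      = ∑ s, ∑ x, ∑ x', A x * A x' * (B (s - x) * B (s - x')) := by
        refine Finset.sum_congr rfl fun s _ => ?_
        rw [sq, conv, Finset.sum_mul_sum]
        exact Finset.sum_congr rfl fun x _ => Finset.sum_congr rfl fun x' _ => by ring
    _ = ∑ x, ∑ x', ∑ s, A x * A x' * (B (s - x) * B (s - x')) := by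
        rw [Finset.sum_comm]
        exact Finset.sum_congr rfl fun x _ => Finset.sum_comm
    _ = ∑ x, ∑ j, A x * A (x + j) * autocorr B j := by
        refine Finset.sum_congr rfl fun x _ => ?_
        rw [← Equiv.sum_comp (Equiv.addLeft x)]
        refine Finset.sum_congr rfl fun j _ => ?_
        rw [← Finset.mul_sum, autocorr]
        congr 1
        rw [← Equiv.sum_comp (Equiv.addRight (x + j))]
        refine Finset.sum_congr rfl fun y _ => ?_
        simp only [Equiv.coe_addRight, Equiv.coe_addLeft]
        rw [show y + (x + j) - x = y + j by ring, show y + (x + j) - (x + j) = y by ring, mul_comm]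
    _ = ∑ j, autocorr A j * autocorr B j := by
        rw [Finset.sum_comm]
        exact Finset.sum_congr rfl fun j _ => by rw [← Finset.sum_mul]; rfl

lemma bellValue_eq (A B C : ZMod 32 → ℤ) :
    bellValue A B C = ∑ z, C z * ∑ s, bell (s + z) * conv A B s := by
  unfold bellValue
  have : ∀ x, ∑ y, ∑ z, bell (x + y + z) * A x * B y * C z =
      ∑ s, ∑ z, bell (s + z) * A x * B (s - x) * C z := fun x => by
    rw [← Equiv.sum_comp (Equiv.subRight x)]
    exact Finset.sum_congr rfl fun s _ => by simp
  simp only [this]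
  calc ∑ x, ∑ s, ∑ z, bell (s + z) * A x * B (s - x) * C z
      = ∑ s, ∑ z, ∑ x, bell (s + z) * A x * B (s - x) * C z := by
        rw [Finset.sum_comm]
        exact Finset.sum_congr rfl fun s _ => Finset.sum_comm
    _ = ∑ z, ∑ s, ∑ x, bell (s + z) * A x * B (s - x) * C z := Finset.sum_comm
    _ = _ := by
        refine Finset.sum_congr rfl fun z _ => ?_
        rw [Finset.mul_sum]
        refine Finset.sum_congr rfl fun s _ => ?_
        rw [conv, Finset.mul_sum, Finset.mul_sum]
        exact Finset.sum_congr rfl fun x _ => by ring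

/-- The left side is the quadratic form of the circulant matrix with entries `autocorr bell (t -
s)`, whose operator norm is at most its absolute row sum. -/
lemma sum_sq_bell_le (p : ZMod 32 → ℤ) :
    ∑ z, (∑ s, bell (s + z) * p s) ^ 2 ≤ (∑ j, |autocorr bell j|) * ∑ s, p s ^ 2 := by
  calc ∑ z, (∑ s, bell (s + z) * p s) ^ 2
      = ∑ s, ∑ t, p s * p t * ∑ z, bell (s + z) * bell (t + z) := by
        simp only [sq]
        simp only [Finset.sum_mul_sum]
        simp only [Finset.mul_sum]
        rw [Finset.sum_comm]
        refine Finset.sum_congr rfl fun s _ => ?_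
        rw [Finset.sum_comm]
        exact Finset.sum_congr rfl fun t _ => Finset.sum_congr rfl fun z _ => by ring
    _ = ∑ s, ∑ j, p s * p (s + j) * autocorr bell j := by
        refine Finset.sum_congr rfl fun s _ => ?_
        rw [← Equiv.sum_comp (Equiv.addLeft s)]
        refine Finset.sum_congr rfl fun j _ => ?_
        congr 1
        rw [autocorr, eq_comm, ← Equiv.sum_comp (Equiv.addLeft s)]
        exact Finset.sum_congr rfl fun z _ => by
          simp only [Equiv.coe_addLeft]; rw [add_right_comm]
    _ = ∑ j, autocorr bell j * autocorr p j := by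
        rw [Finset.sum_comm]
        refine Finset.sum_congr rfl fun j _ => ?_
        rw [autocorr, autocorr, Finset.mul_sum]
        exact Finset.sum_congr rfl fun s _ => by ring
    _ ≤ ∑ j, |autocorr bell j| * ∑ s, p s ^ 2 := by
        refine Finset.sum_le_sum fun j _ => ?_
        refine (le_abs_self _).trans ?_
        rw [abs_mul]
        refine mul_le_mul_of_nonneg_left ?_ (abs_nonneg _)
        have shift : ∑ s, p (s + j) ^ 2 = ∑ s, p s ^ 2 :=
          Equiv.sum_comp (Equiv.addRight j) fun s => p s ^ 2
        have h2 : 2 * |autocorr p j| ≤ 2 * ∑ s, p s ^ 2 := by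
          calc 2 * |autocorr p j| ≤ 2 * ∑ s, |p s * p (s + j)| := by
                gcongr; exact Finset.abs_sum_le_sum_abs _ _
            _ = ∑ s, 2 * (|p s| * |p (s + j)|) := by simp only [abs_mul, Finset.mul_sum]
            _ ≤ ∑ s, (p s ^ 2 + p (s + j) ^ 2) := by
                refine Finset.sum_le_sum fun s _ => ?_
                rw [← sq_abs (p s), ← sq_abs (p (s + j))]
                linarith [two_mul_le_add_sq |p s| |p (s + j)|]
            _ = 2 * ∑ s, p s ^ 2 := by rw [Finset.sum_add_distrib, shift]; ring
        linarith
    _ = _ := by rw [Finset.sum_mul]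

set_option maxRecDepth 100000 in
lemma sum_abs_autocorr_bell :
    ∑ j, |autocorr bell j| = 1141194335249826217124 := by
  unfold autocorr
  decide +kernel

lemma sum_sq_sign {C : ZMod 32 → ℤ} (hC : IsSign C) : ∑ z, C z ^ 2 = 32 := by
  rw [Finset.sum_congr rfl fun z _ => show C z ^ 2 = 1 by
    rcases hC.eq_or z with h | h <;> rw [h] <;> rfl]
  simp [ZMod.card]

lemma bellValue_comm_right (A B C : ZMod 32 → ℤ) : bellValue A B C = bellValue A C B := by
  rw [bellValue_rotate, bellValue_rotate, bellValue_swap]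

/-- The Bell inequality for strategies two of which have a small additive energy. -/
lemma bellValue_le_of_energy_le {A B C : ZMod 32 → ℤ} (hC : IsSign C) (hA : energy A ≤ 7008)
    (hB : energy B ≤ 7008) : bellValue A B C ≤ 8 * 2000797767168 := by
  have h1 : bellValue A B C ^ 2 ≤ 32 * (1141194335249826217124 * ∑ s, conv A B s ^ 2) := by
    rw [bellValue_eq]
    refine (Finset.sum_mul_sq_le_sq_mul_sq _ _ _).trans ?_
    rw [sum_sq_sign hC, ← sum_abs_autocorr_bell]
    gcongr
    exact sum_sq_bell_le _
  have hc0 : 0 ≤ ∑ s, conv A B s ^ 2 := Finset.sum_nonneg fun s _ => sq_nonneg _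
  have h2 : (∑ s, conv A B s ^ 2) ^ 2 ≤ 7008 ^ 2 := by
    rw [sum_conv_sq]
    refine (Finset.sum_mul_sq_le_sq_mul_sq _ _ _).trans ?_
    rw [sq 7008]
    exact mul_le_mul hA hB (Finset.sum_nonneg fun s _ => sq_nonneg _) (by norm_num)
  have h3 : ∑ s, conv A B s ^ 2 ≤ 7008 := by
    exact (abs_le_of_sq_le_sq' h2 (by norm_num)).2
  -- The energy bound 7008 is chosen so that `32 * 1141194335249826217124 * 7008` stays just below
  -- the square of the claimed bound.
  refine (abs_le_of_sq_le_sq' (h1.trans ?_) (by norm_num)).2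
  linarith

/-! ### Binary codes and the finite checks -/

/-- The indicator of the value `1` of a sign sequence. -/
def bit (A : ZMod 32 → ℤ) (x : ℕ) : ℕ := if A x = 1 then 1 else 0

/-- The binary code of a sign sequence. -/
def code (A : ZMod 32 → ℤ) : ℕ := pack 2 16 (bit A)

lemma bit_lt (A : ZMod 32 → ℤ) (x : ℕ) : bit A x < 2 := by
  unfold bit; split_ifs <;> norm_num

lemma IsSign.two_mul_bit {A : ZMod 32 → ℤ} (hA : IsSign A) (x : ℕ) :
    (2 * bit A x : ℤ) = 1 + A x := by
  unfold bit
  rcases hA.eq_or x with h | h <;> simp [h]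

lemma IsSign.bit_add {A : ZMod 32 → ℤ} (hA : IsSign A) (x : ℕ) :
    bit A (x + 16) = 1 - bit A x := by
  have h1 := hA.two_mul_bit x
  have h2 := hA.two_mul_bit (x + 16)
  push_cast at h2
  rw [hA.add_eq] at h2
  omega

lemma code_lt (A : ZMod 32 → ℤ) : code A < 65536 := by
  have h : ∀ x ∈ Finset.range 16, bit A x * 2 ^ x ≤ 2 ^ x := fun x _ => by
    have := bit_lt A x
    nlinarith [pow_pos (two_pos (α := ℕ)) x]
  calc code A ≤ ∑ x ∈ Finset.range 16, 2 ^ x := Finset.sum_le_sum h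
    _ < 65536 := by decide

lemma code_shift (A : ZMod 32 → ℤ) (j : ℕ) :
    code (fun x => A (x + j)) = pack 2 16 fun z => bit A (z + j) := by
  exact pack_congr fun z _ => by simp [bit]

lemma IsSign.exists_isMin {A : ZMod 32 → ℤ} (hA : IsSign A) :
    ∃ j : ZMod 32, isMin (code fun x => A (x + j)) 32 (code fun x => A (x + j)) = true := by
  obtain ⟨j, hj⟩ := Finite.exists_min fun j : ZMod 32 => code fun x => A (x + j)
  refine ⟨j, ?_⟩
  nth_rewrite 2 [code]
  refine isMin_pack 32 (bit_lt _) (hA.shift j).bit_add fun i => ?_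
  rw [← code_shift]
  refine (hj (i + j)).trans_eq ?_
  simp [add_assoc]

/-- A sum of rotations of a packed antiperiodic sequence, with the signs `A`. -/
lemma IsSign.sweep_eq {A : ZMod 32 → ℤ} (hA : IsSign A) {T K : ℕ} (hT : 2 * K < T)
    {H : ZMod 32 → ℤ} {u : ℕ → ℕ} (hH : ∀ x, H (x + 16) = -H x)
    (hu : ∀ z : ℕ, (u z : ℤ) = K + H z) (hb : ∀ z, |H z| ≤ K) :
    ∃ d : ℕ → ℕ, sweep T (2 * K) (pack T 16 fun _ => 2 * K) 16 (code A) (pack T 16 u) =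
        pack T 16 d ∧ (∀ z : ℕ, (d z : ℤ) = 16 * K + ∑ i ∈ Finset.range 16, A i * H (z + i)) ∧
      ∀ z, d z ≤ 32 * K := by
  have hu1 : ∀ z, u z ≤ 2 * K := fun z => by
    have := hu z; have := (abs_le.1 (hb z)).2; omega
  refine ⟨_, sweep_pack hT 16 (bit_lt A) hu1 fun z => ?_, fun z => ?_, fun z => ?_⟩
  · have h1 := hu z
    have h2 := hu (z + 16)
    push_cast at h2
    rw [hH] at h2
    omega
  · have : (16 * K : ℤ) = ∑ i ∈ Finset.range 16, (K : ℤ) := by simp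
    rw [this, ← Finset.sum_add_distrib, Nat.cast_sum]
    refine Finset.sum_congr rfl fun i _ => ?_
    have h1 := hu (z + i)
    have h2 := hA.two_mul_bit i
    have h3 := hu1 (z + i)
    push_cast at h1
    split_ifs with h
    · rw [h] at h2
      rw [h1, show A i = 1 by push_cast at h2; omega, one_mul]
    · have : bit A i = 0 := by have := bit_lt A i; omega
      rw [this] at h2
      rw [Nat.cast_sub h3, h1, show A i = -1 by push_cast at h2; omega]
      push_cast
      ring
  · calc _ ≤ ∑ i ∈ Finset.range 16, 2 * K := by
          refine Finset.sum_le_sum fun i _ => ?_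
          split_ifs
          · exact hu1 _
          · omega
      _ = 32 * K := by simp; ring

/-- The additive energy of a sign sequence from its code, up to the factor `8`. -/
def energyOfCode (n : ℕ) : ℕ :=
  digitSum (fun d => Nat.pow (dist d 16) 2) 64 16
    (sweep 64 2 2515179762357598018842665090 16 n (packBits 64 16 n))

lemma IsSign.autocorr_eq {A : ZMod 32 → ℤ} (hA : IsSign A) (j : ZMod 32) :
    autocorr A j = 2 * ∑ i ∈ Finset.range 16, A i * A (j + i) := by
  unfold autocorr
  rw [sum_zmod_eq_two_mul fun x => by rw [add_right_comm, hA.add_eq, hA.add_eq]; ring]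
  simp only [add_comm]

/-- Each autocorrelation is twice a half-period sum, which contributes `4` after squaring; summing
over half the shifts contributes another `2`. The offset `16` in `energyOfCode` comes from sixteen
digits of offset `1`. -/
lemma IsSign.energy_eq {A : ZMod 32 → ℤ} (hA : IsSign A) : energy A = 8 * energyOfCode (code A) := by
  have hper : ∀ j, autocorr A (j + 16) ^ 2 = autocorr A j ^ 2 := fun j => by
    have : autocorr A (j + 16) = -autocorr A j := by
      unfold autocorr
      rw [← Finset.sum_neg_distrib]
      exact Finset.sum_congr rfl fun x _ => by rw [← add_assoc, hA.add_eq]; ring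
    rw [this, neg_sq]
  obtain ⟨d, h1, h2, h3⟩ := hA.sweep_eq (T := 64) (K := 1) (by norm_num) (u := fun z => 2 * bit A z)
    hA.add_eq (fun z => by push_cast; exact hA.two_mul_bit z)
    (fun z => by rcases hA.eq_or z with h | h <;> simp [h])
  have hS : (pack 64 16 fun _ => 2 * 1) = 2515179762357598018842665090 := by decide +kernel
  rw [hS] at h1
  have h4 : energyOfCode (code A) = ∑ z ∈ Finset.range 16, dist (d z) 16 ^ 2 := by
    unfold energyOfCode
    rw [show packBits 64 16 (code A) = pack 64 16 fun z => 2 * bit A z from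
      packBits_pack 16 (bit_lt A)]
    rw [show (2 : ℕ) = 2 * 1 from rfl]
    rw [h1]
    exact digitSum_pack _ 16 fun z => (h3 z).trans_lt (by norm_num)
  rw [h4, energy, sum_zmod_eq_two_mul hper, Nat.cast_sum, Finset.mul_sum, Finset.mul_sum]
  refine Finset.sum_congr rfl fun j _ => ?_
  rw [Nat.cast_pow, cast_dist, sq_abs, h2, hA.autocorr_eq]
  push_cast
  ring

/-- Codes of representatives of the sign sequences of large additive energy. -/
def largeCodes : List ℕ :=
  [0, 2, 4, 6, 8, 10, 14, 480, 496, 682, 960, 976, 992, 1504, 1952, 2642, 2730, 2898, 2906, 3120,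
    3128, 3184, 3192, 3612, 3632, 3640, 4492, 4504, 4508, 4556, 4710, 4778, 4902, 4918, 4966, 5460,
    5462, 6348, 6540, 6552, 6826, 9362, 9394, 9396, 9420, 9426, 9618, 9650, 9804, 9828, 10570,
    10578, 10602, 10922, 11082, 11442]

def memCodes (n : ℕ) : List ℕ → Bool := List.rec false fun a _ ih => cond (Nat.beq n a) true ih

lemma mem_of_memCodes {n : ℕ} {l : List ℕ} (h : memCodes n l = true) : n ∈ l := by
  induction l with
  | nil => simp [memCodes] at h
  | cons a l ih =>
    have h' : cond (Nat.beq n a) true (memCodes n l) = true := h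
    cases hp : Nat.beq n a with
    | false => exact List.mem_cons_of_mem _ (ih (by simpa [hp] using h'))
    | true => rw [Nat.eq_of_beq_eq_true hp]; exact List.mem_cons_self

/-- Whether `n` is not a minimal code, codes a sequence of small energy, or is listed. -/
def codeCheck (n : ℕ) : Bool :=
  cond (isMin n 32 n) (cond (Nat.ble (energyOfCode n) 876) true (memCodes n largeCodes)) true

/-- Energy is rotation invariant, so only the codes minimal among their rotations matter. The bound
`876` in `codeCheck` is `7008 / 8`. -/
lemma codeCheck_all : checkUpTo codeCheck 65536 = true := by decide +kernel

lemma autocorr_shift (A : ZMod 32 → ℤ) (j : ZMod 32) :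
    autocorr (fun x => A (x + j)) = autocorr A := by
  funext i
  unfold autocorr
  rw [eq_comm, ← Equiv.sum_comp (Equiv.addRight j)]
  exact Finset.sum_congr rfl fun x _ => by simp only [Equiv.coe_addRight]; rw [add_right_comm]

lemma energy_shift (A : ZMod 32 → ℤ) (j : ZMod 32) :
    energy (fun x => A (x + j)) = energy A := by
  unfold energy
  rw [autocorr_shift]

lemma IsSign.exists_code_mem {A : ZMod 32 → ℤ} (hA : IsSign A) (h : 7008 < energy A) :
    ∃ j : ZMod 32, (code fun x => A (x + j)) ∈ largeCodes := by
  obtain ⟨j, hj⟩ := hA.exists_isMin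
  refine ⟨j, ?_⟩
  have hE := energy_shift A j
  have hc := checkUpTo_spec codeCheck_all _ (code_lt fun x => A (x + j))
  rw [(hA.shift j).energy_eq] at hE
  have hb : Nat.ble (energyOfCode (code fun x => A (x + j))) 876 = false := by
    rw [Bool.eq_false_iff]
    intro h'
    have := Nat.le_of_ble_eq_true h'
    omega
  rw [codeCheck, hj, hb, cond_true, cond_false] at hc
  exact mem_of_memCodes hc

/-- The packed values `2 ^ 33 + bell z`. -/
def packedBell : ℕ :=
  17577065335315320542156793523123252250026947883994064533750709117413417743397139105396152279136066071487643641034279820314763539771900063714336427785905950172480979107787498051421241203991957310517283702729611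

def packedOnes : ℕ :=
  4784065733064082916234207357831467837522908912035763061162727479550135126159650740700318705829779192887233266497545327904095328297605928875006079707606266974777962844031542973306764660556067965501441

/-- The maximum of the Bell functional over the third strategy, from the codes of the others. -/
def pairValue (a b : ℕ) : ℕ :=
  digitSum (fun d => dist d (2 ^ 41)) (2 ^ 44) 16
    (sweep (2 ^ 44) (2 ^ 38) (2 ^ 38 * packedOnes) 16 b
      (sweep (2 ^ 44) (2 ^ 34) (2 ^ 34 * packedOnes) 16 a packedBell))

lemma pairCheck_all : checkAll (fun a => checkAll (fun b =>
    Nat.ble (pairValue a b) 2000797767168) largeCodes) largeCodes = true := by decide +kernel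

lemma pack_const (K : ℕ) : (pack (2 ^ 44) 16 fun _ => K) = K * packedOnes := by
  rw [pack, ← Finset.mul_sum]
  congr 1

lemma packedBell_eq : packedBell = pack (2 ^ 44) 16 fun z => (2 ^ 33 + bell z).toNat := by
  decide +kernel

/-- Two sweeps correlate `bell` with `A` and then with `B`. The best third strategy takes the sign
of each entry, which leaves the sum of absolute values. Offsets grow as `2 ^ 33`, `2 ^ 37`, `2 ^
41`, and the final digits are at most `2 ^ 42`, so base `2 ^ 44` has no carries. -/
lemma IsSign.pairValue_eq {A B : ZMod 32 → ℤ} (hA : IsSign A) (hB : IsSign B) :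
    (pairValue (code A) (code B) : ℤ) = ∑ z ∈ Finset.range 16,
      |∑ y ∈ Finset.range 16, B y * ∑ x ∈ Finset.range 16, A x * bell (z + y + x)| := by
  obtain ⟨d, hd1, hd2, hd3⟩ := hA.sweep_eq (T := 2 ^ 44) (K := 2 ^ 33) (by norm_num)
    (H := bell) (u := fun z => (2 ^ 33 + bell z).toNat) bell_add
    (fun z => by
      rw [Int.toNat_of_nonneg (by linarith [(abs_le.1 (abs_bell_le z)).1])]
      norm_num)
    (fun z => by exact_mod_cast abs_bell_le z)
  have hb : ∀ z : ZMod 32, |∑ i ∈ Finset.range 16, A i * bell (z + i)| ≤ ((2 ^ 37 : ℕ) : ℤ) :=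
    fun z => by
      refine (Finset.abs_sum_le_sum_abs _ _).trans ?_
      calc _ ≤ ∑ i ∈ Finset.range 16, (2 ^ 33 : ℤ) := by
            refine Finset.sum_le_sum fun i _ => ?_
            rw [abs_mul]
            rcases hA.eq_or i with h | h <;> simpa [h] using abs_bell_le (z + i)
        _ = ((2 ^ 37 : ℕ) : ℤ) := by simp
  obtain ⟨e, he1, he2, he3⟩ := hB.sweep_eq (T := 2 ^ 44) (K := 2 ^ 37) (by norm_num)
    (H := fun z => ∑ i ∈ Finset.range 16, A i * bell (z + i)) (u := d)
    (fun x => by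
      rw [← Finset.sum_neg_distrib]
      exact Finset.sum_congr rfl fun i _ => by rw [add_right_comm, bell_add]; ring)
    (fun z => by rw [hd2]; norm_num) hb
  rw [pack_const, ← packedBell_eq] at hd1
  rw [pack_const] at he1
  have h : pairValue (code A) (code B) = ∑ z ∈ Finset.range 16, dist (e z) (2 ^ 41) := by
    unfold pairValue
    rw [show (2 : ℕ) ^ 34 = 2 * 2 ^ 33 by norm_num, show (2 : ℕ) ^ 38 = 2 * 2 ^ 37 by norm_num,
      hd1, he1]
    have he4 : ∀ z, e z < 2 ^ 44 := fun z => (he3 z).trans_lt (by norm_num)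
    rw [digitSum_pack _ 16 he4]
  rw [h, Nat.cast_sum]
  refine Finset.sum_congr rfl fun z _ => ?_
  rw [cast_dist, he2, show ((2 ^ 41 : ℕ) : ℤ) = 16 * ((2 ^ 37 : ℕ) : ℤ) by norm_num,
    add_sub_cancel_left]

/-- In each of the three variables the summand is a product of two antiperiodic factors, hence has
period 16; every halving of a range gives a factor `2`. -/
lemma bellValue_eq_eight_mul {A B C : ZMod 32 → ℤ} (hA : IsSign A) (hB : IsSign B)
    (hC : IsSign C) : bellValue A B C = 8 * ∑ z ∈ Finset.range 16, C z *
      ∑ y ∈ Finset.range 16, B y * ∑ x ∈ Finset.range 16, A x * bell (z + y + x) := by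
  have h1 : ∀ s, ∑ x, A x * bell (s + x) = 2 * ∑ x ∈ Finset.range 16, A x * bell (s + x) :=
    fun s => sum_zmod_eq_two_mul fun x => by rw [hA.add_eq, ← add_assoc, bell_add]; ring
  have h2 : ∀ s, ∑ y, B y * ∑ x, A x * bell (s + y + x) =
      2 * ∑ y ∈ Finset.range 16, B y * ∑ x, A x * bell (s + y + x) :=
    fun s => sum_zmod_eq_two_mul fun y => by
      rw [hB.add_eq, neg_mul, ← mul_neg, ← Finset.sum_neg_distrib]
      congr 1
      exact Finset.sum_congr rfl fun x _ => by
        rw [show s + (y + 16) + x = s + y + x + 16 by ring, bell_add]; ring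
  have h3 : ∑ z, C z * ∑ y, B y * ∑ x, A x * bell (z + y + x) =
      2 * ∑ z ∈ Finset.range 16, C z * ∑ y, B y * ∑ x, A x * bell (z + y + x) :=
    sum_zmod_eq_two_mul fun z => by
      rw [hC.add_eq, neg_mul, ← mul_neg, ← Finset.sum_neg_distrib]
      congr 1
      refine Finset.sum_congr rfl fun y _ => ?_
      rw [← mul_neg, ← Finset.sum_neg_distrib]
      congr 1
      exact Finset.sum_congr rfl fun x _ => by
        rw [show z + 16 + y + x = z + y + x + 16 by ring, bell_add]; ring
  have h4 : bellValue A B C = ∑ z, C z * ∑ y, B y * ∑ x, A x * bell (z + y + x) := by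
    rw [bellValue_rotate, bellValue_rotate]
    unfold bellValue
    refine Finset.sum_congr rfl fun z _ => ?_
    rw [Finset.mul_sum, Finset.sum_comm]
    refine Finset.sum_congr rfl fun y _ => ?_
    rw [Finset.mul_sum, Finset.mul_sum]
    exact Finset.sum_congr rfl fun x _ => by rw [add_right_comm z x y]; ring
  rw [h4, h3]
  simp only [h2]
  simp only [h1, mul_left_comm _ (2 : ℤ), ← Finset.mul_sum]
  ring

lemma bellValue_le_of_code_mem {A B C : ZMod 32 → ℤ} (hA : IsSign A) (hB : IsSign B)
    (hC : IsSign C) (hA' : code A ∈ largeCodes) (hB' : code B ∈ largeCodes) :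
    bellValue A B C ≤ 8 * 2000797767168 := by
  rw [bellValue_eq_eight_mul hA hB hC]
  have h := Nat.le_of_ble_eq_true (checkAll_spec (checkAll_spec pairCheck_all _ hA') _ hB')
  have h' : (pairValue (code A) (code B) : ℤ) ≤ 2000797767168 := by exact_mod_cast h
  rw [hA.pairValue_eq hB] at h'
  refine mul_le_mul_of_nonneg_left (le_trans (Finset.sum_le_sum fun z _ => ?_) h') (by norm_num)
  rcases hC.eq_or z with h | h
  · rw [h, one_mul]; exact le_abs_self _
  · rw [h, neg_one_mul]; exact neg_le_abs _

lemma bellValue_le_of_lt_energy {A B C : ZMod 32 → ℤ} (hA : IsSign A) (hB : IsSign B)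
    (hC : IsSign C) (hA' : 7008 < energy A) (hB' : 7008 < energy B) :
    bellValue A B C ≤ 8 * 2000797767168 := by
  obtain ⟨i, hi⟩ := hA.exists_code_mem hA'
  obtain ⟨j, hj⟩ := hB.exists_code_mem hB'
  rw [← bellValue_shift A B C i j]
  refine bellValue_le_of_code_mem (hA.shift i) (hB.shift j) ?_ hi hj
  simpa [sub_eq_add_neg, add_assoc] using hC.shift (-i - j)

/-- The Bell inequality for deterministic strategies. -/
theorem bellValue_le {A B C : ZMod 32 → ℤ} (hA : IsSign A) (hB : IsSign B) (hC : IsSign C) :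
    bellValue A B C ≤ 8 * 2000797767168 := by
  -- Two of the three energies lie on the same side of 7008; the symmetry of the functional moves
  -- them to the first two places.
  rcases le_or_gt (energy A) 7008 with a | a <;> rcases le_or_gt (energy B) 7008 with b | b
  · exact bellValue_le_of_energy_le hC a b
  · rcases le_or_gt (energy C) 7008 with c | c
    · rw [bellValue_comm_right]; exact bellValue_le_of_energy_le hB a c
    · rw [bellValue_rotate]; exact bellValue_le_of_lt_energy hB hC hA b c
  · rcases le_or_gt (energy C) 7008 with c | c
    · rw [bellValue_rotate]; exact bellValue_le_of_energy_le hA b c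
    · rw [bellValue_comm_right]; exact bellValue_le_of_lt_energy hA hC hB a c
  · exact bellValue_le_of_lt_energy hA hB hC a b

/-! ### The Bell inequality for arbitrary responses and the upper bound -/

lemma exists_isSign (e h : ℕ → ℝ) (he : ∀ x, |e x| ≤ 1) :
    ∃ A : ZMod 32 → ℤ, IsSign A ∧
      ∑ x ∈ Finset.range 16, e x * h x ≤ ∑ x ∈ Finset.range 16, (A x : ℝ) * h x := by
  have hval : ∀ x : ZMod 32, (x + 16).val = if x.val < 16 then x.val + 16 else x.val - 16 := by
    decide
  refine ⟨fun x => if x.val < 16 then (if 0 ≤ h x.val then 1 else -1) else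
    -(if 0 ≤ h (x.val - 16) then 1 else -1), ⟨fun x => ?_, fun x => ?_⟩, ?_⟩
  · have hx : x.val < 32 := ZMod.val_lt x
    rw [hval]
    by_cases h' : x.val < 16
    · simp [h']
    · have : x.val - 16 < 16 := by omega
      simp [h', this]
  · split_ifs <;> simp
  · refine Finset.sum_le_sum fun x hx => ?_
    have hx' : ((x : ZMod 32)).val = x :=
      ZMod.val_cast_of_lt ((Finset.mem_range.1 hx).trans (by norm_num))
    simp only [hx', Finset.mem_range.1 hx, if_true]
    refine (le_abs_self _).trans ?_
    rw [abs_mul]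
    calc |e x| * |h x| ≤ 1 * |h x| := by gcongr; exact he x
      _ = _ := by
        split_ifs with h0
        · simp [abs_of_nonneg h0]
        · simp [abs_of_neg (not_le.1 h0)]

/-- The Bell inequality for arbitrary responses. -/
theorem bell_sum_le {e f g : ℕ → ℝ} (he : ∀ x, |e x| ≤ 1) (hf : ∀ x, |f x| ≤ 1)
    (hg : ∀ x, |g x| ≤ 1) :
    ∑ x ∈ Finset.range 16, ∑ y ∈ Finset.range 16, ∑ z ∈ Finset.range 16,
      (bell (x + y + z) : ℝ) * (e x * f y * g z) ≤ 2000797767168 := by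
  -- The form is linear in each response, so the three are replaced by signs one at a time without
  -- decreasing the sum.
  obtain ⟨A, hA, hA'⟩ := exists_isSign e (fun x => ∑ y ∈ Finset.range 16,
    ∑ z ∈ Finset.range 16, (bell (x + y + z) : ℝ) * (f y * g z)) he
  obtain ⟨B, hB, hB'⟩ := exists_isSign f (fun y => ∑ x ∈ Finset.range 16,
    ∑ z ∈ Finset.range 16, (bell (x + y + z) : ℝ) * (A x * g z)) hf
  obtain ⟨C, hC, hC'⟩ := exists_isSign g (fun z => ∑ x ∈ Finset.range 16,
    ∑ y ∈ Finset.range 16, (bell (x + y + z) : ℝ) * (A x * B y)) hg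
  have key : ((bellValue A B C : ℤ) : ℝ) ≤ 8 * 2000797767168 := by
    exact_mod_cast bellValue_le hA hB hC
  rw [bellValue_eq_eight_mul hA hB hC] at key
  push_cast at key
  have e1 : ∑ x ∈ Finset.range 16, ∑ y ∈ Finset.range 16, ∑ z ∈ Finset.range 16,
      (bell (x + y + z) : ℝ) * (e x * f y * g z) = ∑ x ∈ Finset.range 16, e x *
        ∑ y ∈ Finset.range 16, ∑ z ∈ Finset.range 16, (bell (x + y + z) : ℝ) * (f y * g z) := by
    simp only [Finset.mul_sum]
    exact Finset.sum_congr rfl fun x _ => Finset.sum_congr rfl fun y _ =>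
      Finset.sum_congr rfl fun z _ => by ring
  have e2 : ∑ x ∈ Finset.range 16, (A x : ℝ) *
        ∑ y ∈ Finset.range 16, ∑ z ∈ Finset.range 16, (bell (x + y + z) : ℝ) * (f y * g z) =
      ∑ y ∈ Finset.range 16, f y * ∑ x ∈ Finset.range 16,
        ∑ z ∈ Finset.range 16, (bell (x + y + z) : ℝ) * (A x * g z) := by
    simp only [Finset.mul_sum]
    rw [Finset.sum_comm]
    exact Finset.sum_congr rfl fun x _ => Finset.sum_congr rfl fun y _ =>
      Finset.sum_congr rfl fun z _ => by ring
  have e3 : ∑ y ∈ Finset.range 16, (B y : ℝ) * ∑ x ∈ Finset.range 16,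
        ∑ z ∈ Finset.range 16, (bell (x + y + z) : ℝ) * (A x * g z) =
      ∑ z ∈ Finset.range 16, g z * ∑ x ∈ Finset.range 16,
        ∑ y ∈ Finset.range 16, (bell (x + y + z) : ℝ) * (A x * B y) := by
    simp only [Finset.mul_sum]
    rw [Finset.sum_comm, Finset.sum_congr rfl fun x _ => Finset.sum_comm, Finset.sum_comm]
    exact Finset.sum_congr rfl fun x _ => Finset.sum_congr rfl fun y _ =>
      Finset.sum_congr rfl fun z _ => by ring
  have e4 : ∑ z ∈ Finset.range 16, (C z : ℝ) * ∑ x ∈ Finset.range 16,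
        ∑ y ∈ Finset.range 16, (bell (x + y + z) : ℝ) * (A x * B y) =
      ∑ z ∈ Finset.range 16, (C z : ℝ) * ∑ y ∈ Finset.range 16, (B y : ℝ) *
        ∑ x ∈ Finset.range 16, (A x : ℝ) * (bell (z + y + x) : ℝ) := by
    refine Finset.sum_congr rfl fun z _ => ?_
    congr 1
    rw [Finset.sum_comm]
    refine Finset.sum_congr rfl fun y _ => ?_
    rw [Finset.mul_sum]
    refine Finset.sum_congr rfl fun x _ => ?_
    rw [show (x + y + z : ZMod 32) = z + y + x by ring]
    ring
  linarith

lemma sum_range_periodic {g : ℕ → ℝ} (h : ∀ n, g (n + 16) = g n) (m : ℕ) :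
    ∑ z ∈ Finset.range 16, g (m + z) = ∑ z ∈ Finset.range 16, g z := by
  induction m with
  | zero => simp
  | succ m ih =>
    rw [← ih, ← add_left_inj (g m)]
    have h1 := Finset.sum_range_succ' (fun z => g (m + z)) 16
    have h2 := Finset.sum_range_succ (fun z => g (m + z)) 16
    simp only [add_zero, h] at h1 h2
    rw [← h2, h1]
    simp only [add_right_comm, add_assoc]

/-- The directions of the regular polygon. -/
def angle (x : ℕ) : ℝ := x * Real.pi / 16

lemma sum_bell_mul_cos : ∑ x ∈ Finset.range 16, ∑ y ∈ Finset.range 16, ∑ z ∈ Finset.range 16,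
      (bell (x + y + z) : ℝ) * Real.cos (angle x + angle y + angle z) =
    256 * ∑ s ∈ Finset.range 16, (bell s : ℝ) * Real.cos (angle s) := by
  have hper : ∀ n : ℕ, (bell (n + 16 : ℕ) : ℝ) * Real.cos (angle (n + 16)) =
      bell n * Real.cos (angle n) := fun n => by
    push_cast
    rw [bell_add, show angle (n + 16) = angle n + Real.pi by unfold angle; push_cast; ring,
      Real.cos_add_pi]
    push_cast
    ring
  have h : ∀ x y z : ℕ, (bell (x + y + z) : ℝ) * Real.cos (angle x + angle y + angle z) =
      (fun n : ℕ => (bell n : ℝ) * Real.cos (angle n)) (x + y + z) := fun x y z => by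
    have : angle x + angle y + angle z = angle (x + y + z) := by unfold angle; push_cast; ring
    simp [this]
  simp only [h, sum_range_periodic (g := fun n : ℕ => (bell n : ℝ) * Real.cos (angle n)) hper]
  simp
  ring

/-- The upper bound on the visibility of a local model for the regular polygon. -/
lemma HasModel.le {v : ℝ} (h : HasModel fun x y z : Fin 16 =>
    v * Real.cos (angle x + angle y + angle z)) :
    v * (256 * ∑ s ∈ Finset.range 16, (bell s : ℝ) * Real.cos (angle s)) ≤ 2000797767168 := by
  obtain ⟨Λ, _, μ, E, F, G, hμ, mE, mF, mG, bE, bF, bG, -, -, -, -, -, -, hT⟩ := h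
  have hi : ∀ x y z, Integrable (fun l => E x l * F y l * G z l) μ := fun x y z =>
    integrable_of_abs_le_one (((mE x).mul (mF y)).mul (mG z))
      fun l => abs_mul_le_one (abs_mul_le_one (bE x l) (bF y l)) (bG z l)
  have hsum : v * (256 * ∑ s ∈ Finset.range 16, (bell s : ℝ) * Real.cos (angle s)) =
      ∑ x : Fin 16, ∑ y : Fin 16, ∑ z : Fin 16,
        (bell ((x : ℕ) + (y : ℕ) + (z : ℕ)) : ℝ) * ∫ l, E x l * F y l * G z l ∂μ := by
    rw [← sum_bell_mul_cos]
    simp only [hT, Finset.sum_range, Finset.mul_sum]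
    exact Finset.sum_congr rfl fun x _ => Finset.sum_congr rfl fun y _ =>
      Finset.sum_congr rfl fun z _ => by ring
  have hint : ∑ x : Fin 16, ∑ y : Fin 16, ∑ z : Fin 16,
        (bell ((x : ℕ) + (y : ℕ) + (z : ℕ)) : ℝ) * ∫ l, E x l * F y l * G z l ∂μ =
      ∫ l, ∑ x : Fin 16, ∑ y : Fin 16, ∑ z : Fin 16,
        (bell ((x : ℕ) + (y : ℕ) + (z : ℕ)) : ℝ) * (E x l * F y l * G z l) ∂μ := by
    rw [integral_finsetSum _ fun x _ => integrable_finsetSum _ fun y _ =>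
      integrable_finsetSum _ fun z _ => (hi x y z).const_mul _]
    refine Finset.sum_congr rfl fun x _ => ?_
    rw [integral_finsetSum _ fun y _ => integrable_finsetSum _ fun z _ => (hi x y z).const_mul _]
    refine Finset.sum_congr rfl fun y _ => ?_
    rw [integral_finsetSum _ fun z _ => (hi x y z).const_mul _]
    exact Finset.sum_congr rfl fun z _ => (integral_const_mul _ _).symm
  rw [hsum, hint]
  have hbound : ∀ l, ∑ x : Fin 16, ∑ y : Fin 16, ∑ z : Fin 16,
      (bell ((x : ℕ) + (y : ℕ) + (z : ℕ)) : ℝ) * (E x l * F y l * G z l) ≤ 2000797767168 := by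
    intro l
    -- Reduction mod 16 merely extends the responses to all naturals; only indices below 16 enter
    -- the sums.
    have h := bell_sum_le (e := fun x => E (Fin.ofNat 16 x) l) (f := fun x => F (Fin.ofNat 16 x) l)
      (g := fun x => G (Fin.ofNat 16 x) l) (fun x => bE _ l) (fun x => bF _ l) (fun x => bG _ l)
    simpa only [Finset.sum_range, Fin.ofNat_val_eq_self] using h
  calc _ ≤ ∫ _, (2000797767168 : ℝ) ∂μ := by
        refine integral_mono ?_ (integrable_const _) hbound
        exact integrable_finsetSum _ fun x _ => integrable_finsetSum _ fun y _ =>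
          integrable_finsetSum _ fun z _ => (hi x y z).const_mul _
    _ = 2000797767168 := by simp

/-! ### The optimal local model -/

/-- The response of the first two parties in the optimal local model. -/
def squareWave (x : ZMod 32) : ℤ := if x.val < 16 then 1 else -1

/-- The response of the third party in the optimal local model. -/
def thirdWave (x : ZMod 32) : ℤ :=
  if x.val = 9 ∨ x.val = 25 then 0 else if 9 < x.val ∧ x.val < 25 then 1 else -1

/-- The correlation of the three responses, after a random rotation. -/
def waveCorr : ZMod 32 → ℤ :=
  ![512, 504, 480, 440, 384, 312, 224, 120, 0, -120, -224, -312, -384, -440, -480, -504, -512,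
    -504, -480, -440, -384, -312, -224, -120, 0, 120, 224, 312, 384, 440, 480, 504]

lemma squareWave_add : ∀ x, squareWave (x + 16) = -squareWave x := by decide

lemma thirdWave_add : ∀ x, thirdWave (x + 16) = -thirdWave x := by decide

lemma abs_squareWave_le (x : ZMod 32) : |(squareWave x : ℝ)| ≤ 1 := by
  have : ∀ x, |squareWave x| ≤ 1 := by decide
  exact_mod_cast this x

lemma abs_thirdWave_le (x : ZMod 32) : |(thirdWave x : ℝ)| ≤ 1 := by
  have : ∀ x, |thirdWave x| ≤ 1 := by decide
  exact_mod_cast this x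

/-- The autoconvolution of the square wave. -/
def triangleWave : ZMod 32 → ℤ :=
  ![-28, -24, -20, -16, -12, -8, -4, 0, 4, 8, 12, 16, 20, 24, 28, 32, 28, 24, 20, 16, 12, 8, 4, 0,
    -4, -8, -12, -16, -20, -24, -28, -32]

lemma conv_squareWave : ∀ s, conv squareWave squareWave s = triangleWave s := by
  unfold conv
  decide +kernel

/-- `thirdWave (-t)` is the sign of `triangleWave t`, including its zeros, so the third response is
the best one against two square waves at `s = 0`. For `0 ≤ n ≤ 8` the result is the parabola `512 -
8 n ^ 2`. -/
lemma sum_triangleWave_mul : ∀ s, ∑ t, triangleWave t * thirdWave (s - t) = waveCorr s := by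
  decide +kernel

lemma waveCorr_eq (s : ZMod 32) :
    ∑ x, ∑ y, squareWave x * squareWave y * thirdWave (s - x - y) = waveCorr s := by
  rw [← sum_triangleWave_mul]
  simp only [← conv_squareWave, conv, Finset.sum_mul]
  rw [Finset.sum_comm (f := fun t x => squareWave x * squareWave (t - x) * thirdWave (s - t))]
  refine Finset.sum_congr rfl fun x _ => ?_
  rw [← Equiv.sum_comp (Equiv.subRight x)]
  exact Finset.sum_congr rfl fun t _ => by simp

/-- The odd multipliers, up to sign. -/
def multiplier : Fin 8 → ZMod 32 := ![1, 3, 5, 7, 9, 11, 13, 15]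

/-- Odd multiplications fix the half period, hence preserve antiperiodicity. -/
lemma mul_multiplier : ∀ i, 16 * multiplier i = 16 := by decide

lemma exists_mul_multiplier : ∀ i, ∃ k, k * multiplier i = 1 := by decide

lemma multiplier_bijective (i : Fin 8) : Function.Bijective fun s => multiplier i * s := by
  obtain ⟨k, hk⟩ := exists_mul_multiplier i
  refine Finite.injective_iff_bijective.1 fun s t h => ?_
  have := congrArg (k * ·) h
  simpa [← mul_assoc, hk] using this

lemma sum_eq_zero_of_antiperiodic {f : ZMod 32 → ℝ} (h : ∀ x, f (x + 16) = -f x) :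
    ∑ x, f x = 0 := by
  have h1 : ∑ x, f (x + 16) = ∑ x, f x := Equiv.sum_comp (Equiv.addRight 16) f
  simp only [h, Finset.sum_neg_distrib] at h1
  linarith

lemma sum_wave_mul (i : Fin 8) (x y z : ZMod 32) :
    ∑ s, ∑ t, squareWave (multiplier i * (x + s)) * squareWave (multiplier i * (y + t)) *
      thirdWave (multiplier i * (z - s - t)) = waveCorr (multiplier i * (x + y + z)) := by
  symm
  rw [← waveCorr_eq, ← (multiplier_bijective i).sum_comp, ← Equiv.sum_comp (Equiv.addLeft x)]
  refine Finset.sum_congr rfl fun s _ => ?_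
  rw [← (multiplier_bijective i).sum_comp, ← Equiv.sum_comp (Equiv.addLeft y)]
  refine Finset.sum_congr rfl fun t _ => ?_
  simp only [Equiv.coe_addLeft]
  rw [show multiplier i * (x + y + z) - multiplier i * (x + s) - multiplier i * (y + t) =
    multiplier i * (z - s - t) by ring]

/-- A measure on a finite type given by weights. -/
def weighted {Λ : Type} [Fintype Λ] [MeasurableSpace Λ] (p : Λ → ℝ) : Measure Λ :=
  ∑ l, ENNReal.ofReal (p l) • Measure.dirac l

lemma integral_weighted {Λ : Type} [Fintype Λ] [MeasurableSpace Λ] [MeasurableSingletonClass Λ]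
    {p : Λ → ℝ} (hp : ∀ l, 0 ≤ p l) (f : Λ → ℝ) : ∫ l, f l ∂(weighted p) = ∑ l, p l * f l := by
  unfold weighted
  rw [integral_finsetSum_measure fun l _ =>
    (integrable_dirac (by simp)).smul_measure ENNReal.ofReal_ne_top]
  refine Finset.sum_congr rfl fun l _ => ?_
  rw [integral_smul_measure, integral_dirac, ENNReal.toReal_ofReal (hp l), smul_eq_mul]

lemma isProbabilityMeasure_weighted {Λ : Type} [Fintype Λ] [MeasurableSpace Λ] {p : Λ → ℝ}
    (hp : ∀ l, 0 ≤ p l) (h : ∑ l, p l = 1) : IsProbabilityMeasure (weighted p) := by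
  refine ⟨?_⟩
  unfold weighted
  simp only [Measure.coe_finsetSum, Finset.sum_apply, Measure.smul_apply, measure_univ,
    smul_eq_mul, mul_one]
  rw [← ENNReal.ofReal_sum_of_nonneg fun l _ => hp l, h, ENNReal.ofReal_one]

/-- A mixture of the images under the odd multipliers of the randomly rotated waves. -/
lemma hasModel_of_weights (w : Fin 8 → ℝ) (hw : ∑ i, |w i| = 1) :
    HasModel fun x y z : Fin 16 => ∑ i, w i *
      (waveCorr (multiplier i * ((x : ℕ) + (y : ℕ) + (z : ℕ))) / 1024 : ℝ) := by
  let Λ := Fin 8 × ZMod 32 × ZMod 32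
  let _ : MeasurableSpace Λ := ⊤
  let p : Λ → ℝ := fun l => |w l.1| / 1024
  have hp : ∀ l, 0 ≤ p l := fun l => by positivity
  -- A negative weight is realised by flipping the third party's response.
  let σ : Fin 8 → ℝ := fun i => if 0 ≤ w i then 1 else -1
  have hσ : ∀ i, |w i| * σ i = w i := fun i => by
    simp only [σ]
    split_ifs with h
    · rw [abs_of_nonneg h, mul_one]
    · rw [abs_of_neg (not_le.1 h)]; ring
  have hσ' : ∀ i, |σ i| = 1 := fun i => by simp only [σ]; split_ifs <;> simp
  have hs : ∀ i x, squareWave (multiplier i * (x + 16)) = -squareWave (multiplier i * x) :=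
    fun i x => by rw [mul_add, mul_comm _ 16, mul_multiplier, squareWave_add]
  have ht : ∀ i x, thirdWave (multiplier i * (x + 16)) = -thirdWave (multiplier i * x) :=
    fun i x => by rw [mul_add, mul_comm _ 16, mul_multiplier, thirdWave_add]
  have ht' : ∀ i x, thirdWave (multiplier i * (x - 16)) = -thirdWave (multiplier i * x) :=
    fun i x => by rw [← neg_eq_iff_eq_neg, ← ht, sub_add_cancel]
  have sum_eq : ∀ f : Λ → ℝ, ∫ l, f l ∂(weighted p) =
      ∑ i, |w i| / 1024 * ∑ s, ∑ t, f (i, s, t) := fun f => by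
    rw [integral_weighted hp, Fintype.sum_prod_type]
    refine Finset.sum_congr rfl fun i _ => ?_
    rw [Fintype.sum_prod_type, Finset.mul_sum]
    refine Finset.sum_congr rfl fun s _ => ?_
    rw [Finset.mul_sum]
  have zero : ∀ f : Λ → ℝ, (∀ i, ∑ s, ∑ t, f (i, s, t) = 0) → ∫ l, f l ∂(weighted p) = 0 :=
    fun f hf => by rw [sum_eq]; simp [hf]
  refine ⟨Λ, _, weighted p,
    fun x l => squareWave (multiplier l.1 * ((x : ℕ) + l.2.1)),
    fun y l => squareWave (multiplier l.1 * ((y : ℕ) + l.2.2)),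
    fun z l => σ l.1 * thirdWave (multiplier l.1 * ((z : ℕ) - l.2.1 - l.2.2)),
    isProbabilityMeasure_weighted hp ?_, fun x => measurable_from_top,
    fun x => measurable_from_top, fun x => measurable_from_top,
    fun x l => abs_squareWave_le _, fun x l => abs_squareWave_le _, fun x l => ?_, fun x => ?_, fun x => ?_,
    fun x => ?_, fun x y => ?_, fun x z => ?_, fun y z => ?_, fun x y z => ?_⟩
  · rw [Fintype.sum_prod_type]
    simp [p, ZMod.card, ← Finset.sum_div, ← Finset.mul_sum, hw]
  · rw [abs_mul, hσ', one_mul]; exact abs_thirdWave_le _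
  -- Every one- and two-party product is antiperiodic in at least one of the two independent
  -- rotations, so its average vanishes.
  · refine zero _ fun i => ?_
    rw [Finset.sum_comm]
    refine Finset.sum_eq_zero fun t _ => sum_eq_zero_of_antiperiodic fun s => ?_
    simp [← add_assoc, hs]
  · refine zero _ fun i => ?_
    refine Finset.sum_eq_zero fun s _ => sum_eq_zero_of_antiperiodic fun t => ?_
    simp [← add_assoc, hs]
  · refine zero _ fun i => ?_
    refine Finset.sum_eq_zero fun s _ => sum_eq_zero_of_antiperiodic fun t => ?_
    simp [← sub_sub, ht']
  · refine zero _ fun i => ?_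
    refine Finset.sum_eq_zero fun s _ => sum_eq_zero_of_antiperiodic fun t => ?_
    simp [← add_assoc, hs]
  · refine zero _ fun i => ?_
    refine Finset.sum_eq_zero fun s _ => sum_eq_zero_of_antiperiodic fun t => ?_
    simp [← sub_sub, ht']
  · refine zero _ fun i => ?_
    rw [Finset.sum_comm]
    refine Finset.sum_eq_zero fun t _ => sum_eq_zero_of_antiperiodic fun s => ?_
    simp [← sub_sub, sub_right_comm _ (16 : ZMod 32), ht']
  · rw [sum_eq]
    refine Finset.sum_congr rfl fun i _ => ?_
    rw [← sum_wave_mul]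
    push_cast
    conv_rhs => rw [← hσ i]
    simp only [Finset.mul_sum, Finset.sum_div]
    exact Finset.sum_congr rfl fun s _ => Finset.sum_congr rfl fun t _ => by ring

/-! ### From the polygon to the whole plane -/

lemma exists_angle (n : ℤ) : ∃ (j : Fin 16) (ε : ℝ), |ε| = 1 ∧
    Real.cos (n * (Real.pi / 16)) = ε * Real.cos (angle (j : ℕ)) ∧
    Real.sin (n * (Real.pi / 16)) = ε * Real.sin (angle (j : ℕ)) := by
  have h0 : 0 ≤ n % 16 := Int.emod_nonneg n (by norm_num)
  have h1 : n % 16 < 16 := Int.emod_lt_of_pos n (by norm_num)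
  have hj : (((n % 16).toNat : ℕ) : ℝ) = ((n % 16 : ℤ) : ℝ) := by
    rw [← Int.cast_natCast, Int.toNat_of_nonneg h0]
  have hn : (n : ℝ) = ((n % 16 : ℤ) : ℝ) + 16 * ((n / 16 : ℤ) : ℝ) := by
    exact_mod_cast (Int.emod_add_mul_ediv n 16).symm
  have h : (n : ℝ) * (Real.pi / 16) = angle (n % 16).toNat + (n / 16 : ℤ) * Real.pi := by
    rw [angle, hj]
    linear_combination (Real.pi / 16) * hn
  exact ⟨⟨(n % 16).toNat, by omega⟩, (-1) ^ (n / 16), by simp [abs_zpow],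
    by rw [h, Real.cos_add_int_mul_pi], by rw [h, Real.sin_add_int_mul_pi]⟩

lemma sum_mul_sum_mul_sum {ι : Type} [Fintype ι] (f g h : ι → ℝ) :
    (∑ x, f x) * (∑ y, g y) * (∑ z, h z) = ∑ x, ∑ y, ∑ z, f x * g y * h z := by
  rw [Finset.sum_mul_sum, Finset.sum_mul]
  refine Finset.sum_congr rfl fun x _ => ?_
  rw [Finset.sum_mul]
  exact Finset.sum_congr rfl fun y _ => Finset.mul_sum _ _ _

/-- A unit vector of the plane, shrunk by `cos (π / 32)`, lies in the regular 32-gon. -/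
lemma exists_polygon_combination (t : ℝ) : ∃ q : Fin 16 → ℝ, ∑ i, |q i| ≤ 1 ∧
    ∑ i, q i * Real.cos (angle (i : ℕ)) = Real.cos (Real.pi / 32) * Real.cos t ∧
    ∑ i, q i * Real.sin (angle (i : ℕ)) = Real.cos (Real.pi / 32) * Real.sin t := by
  obtain ⟨δ, hδ⟩ : ∃ δ, δ = Real.pi / 16 := ⟨_, rfl⟩
  have hπ := Real.pi_pos
  have hδ0 : 0 < δ := by rw [hδ]; positivity
  have hδπ : δ < Real.pi := by rw [hδ]; linarith
  have hsin : 0 < Real.sin δ := Real.sin_pos_of_pos_of_lt_pi hδ0 hδπ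
  obtain ⟨n, hn⟩ : ∃ n : ℤ, n = ⌊t / δ⌋ := ⟨_, rfl⟩
  obtain ⟨r, hr⟩ : ∃ r, r = t - n * δ := ⟨_, rfl⟩
  have hr0 : 0 ≤ r := by
    have := Int.floor_le (t / δ)
    rw [← hn, le_div_iff₀ hδ0] at this
    linarith
  have hr1 : r ≤ δ := by
    have := (Int.lt_floor_add_one (t / δ)).le
    rw [← hn, div_le_iff₀ hδ0] at this
    linarith
  obtain ⟨j₀, ε₀, hε₀, hc₀, hs₀⟩ := exists_angle n
  obtain ⟨j₁, ε₁, hε₁, hc₁, hs₁⟩ := exists_angle (n + 1)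
  rw [← hδ] at hc₀ hs₀ hc₁ hs₁
  obtain ⟨k, hk⟩ : ∃ k, k = Real.cos (Real.pi / 32) := ⟨_, rfl⟩
  have hk0 : 0 ≤ k := hk ▸ Real.cos_nonneg_of_mem_Icc ⟨by linarith, by linarith⟩
  -- Coordinates of the shrunk vector in the basis of the two vertices enclosing it, at angles `n *
  -- δ` and `(n + 1) * δ`.
  obtain ⟨c₀, hc⟩ : ∃ c, c = k * Real.sin (δ - r) / Real.sin δ := ⟨_, rfl⟩
  obtain ⟨c₁, hd⟩ : ∃ c, c = k * Real.sin r / Real.sin δ := ⟨_, rfl⟩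
  have hc0 : 0 ≤ c₀ := by
    rw [hc]
    exact div_nonneg (mul_nonneg hk0 (Real.sin_nonneg_of_nonneg_of_le_pi (by linarith)
      (by linarith))) hsin.le
  have hd0 : 0 ≤ c₁ := by
    rw [hd]
    exact div_nonneg (mul_nonneg hk0 (Real.sin_nonneg_of_nonneg_of_le_pi hr0 (by linarith)))
      hsin.le
  have ht : t = n * δ + r := by rw [hr]; ring
  have hn1 : ((n + 1 : ℤ) : ℝ) * δ = n * δ + δ := by push_cast; ring
  rw [hn1] at hc₁ hs₁
  refine ⟨fun i => c₀ * ε₀ * (if i = j₀ then 1 else 0) + c₁ * ε₁ * (if i = j₁ then 1 else 0),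
    ?_, ?_, ?_⟩
  · have h1 : ∀ i, |c₀ * ε₀ * (if i = j₀ then 1 else 0) + c₁ * ε₁ * (if i = j₁ then 1 else 0)| ≤
        c₀ * (if i = j₀ then 1 else 0) + c₁ * (if i = j₁ then 1 else 0) := fun i => by
      refine (abs_add_le _ _).trans_eq ?_
      simp only [abs_mul, hε₀, hε₁, abs_of_nonneg hc0, abs_of_nonneg hd0, mul_one]
      congr 2 <;> split_ifs <;> simp
    refine (Finset.sum_le_sum fun i _ => h1 i).trans ?_
    rw [Finset.sum_add_distrib]
    simp only [mul_ite, mul_one, mul_zero, Finset.sum_ite_eq', Finset.mem_univ, if_true]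
    have h2 : δ = 2 * (δ / 2) := by ring
    have hk' : k = Real.cos (δ / 2) := by rw [hk, hδ]; congr 1; ring
    -- The shrinking factor is the inradius of the 32-gon; the coordinates sum to `1` exactly at the
    -- midpoint of an edge.
    have hsum : c₀ + c₁ = Real.cos (δ / 2 - r) := by
      rw [hc, hd, ← add_div, div_eq_iff hsin.ne', Real.sin_sub, Real.cos_sub, hk']
      have e1 : Real.sin δ = 2 * Real.sin (δ / 2) * Real.cos (δ / 2) := by
        rw [← Real.sin_two_mul, ← h2]
      have e2 : Real.cos δ = 1 - 2 * Real.sin (δ / 2) ^ 2 := by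
        rw [← Real.cos_two_mul_eq_one_sub, ← h2]
      rw [e1, e2]
      ring
    rw [hsum]
    exact Real.cos_le_one _
  · simp only [add_mul, Finset.sum_add_distrib, mul_ite, mul_one, mul_zero, ite_mul, zero_mul,
      Finset.sum_ite_eq', Finset.mem_univ, if_true]
    rw [mul_assoc, ← hc₀, mul_assoc, ← hc₁, ← hk, ht, hc, hd]
    rw [Real.cos_add, Real.cos_add, Real.sin_sub]
    field_simp
    ring
  · simp only [add_mul, Finset.sum_add_distrib, mul_ite, mul_one, mul_zero, ite_mul, zero_mul,
      Finset.sum_ite_eq', Finset.mem_univ, if_true]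
    rw [mul_assoc, ← hs₀, mul_assoc, ← hs₁, ← hk, ht, hc, hd]
    rw [Real.sin_add, Real.sin_add, Real.sin_sub]
    field_simp
    ring

lemma sum_cos_trilinear {ι : Type} [Fintype ι] (q r s : ι → ℝ) (θ : ι → ℝ) (k α β γ : ℝ)
    (hq : ∑ i, q i * Real.cos (θ i) = k * Real.cos α ∧ ∑ i, q i * Real.sin (θ i) = k * Real.sin α)
    (hr : ∑ i, r i * Real.cos (θ i) = k * Real.cos β ∧ ∑ i, r i * Real.sin (θ i) = k * Real.sin β)
    (hs : ∑ i, s i * Real.cos (θ i) = k * Real.cos γ ∧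
      ∑ i, s i * Real.sin (θ i) = k * Real.sin γ) :
    ∑ x, ∑ y, ∑ z, q x * r y * s z * Real.cos (θ x + θ y + θ z) =
      k ^ 3 * Real.cos (α + β + γ) := by
  have h : ∑ x, ∑ y, ∑ z, q x * r y * s z * Real.cos (θ x + θ y + θ z) =
      (∑ x, q x * Real.cos (θ x)) * (∑ y, r y * Real.cos (θ y)) * (∑ z, s z * Real.cos (θ z)) -
      (∑ x, q x * Real.sin (θ x)) * (∑ y, r y * Real.sin (θ y)) * (∑ z, s z * Real.cos (θ z)) -
      (∑ x, q x * Real.sin (θ x)) * (∑ y, r y * Real.cos (θ y)) * (∑ z, s z * Real.sin (θ z)) -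
      (∑ x, q x * Real.cos (θ x)) * (∑ y, r y * Real.sin (θ y)) *
        (∑ z, s z * Real.sin (θ z)) := by
    simp only [sum_mul_sum_mul_sum, ← Finset.sum_sub_distrib]
    refine Finset.sum_congr rfl fun x _ => Finset.sum_congr rfl fun y _ =>
      Finset.sum_congr rfl fun z _ => ?_
    rw [Real.cos_add, Real.cos_add, Real.sin_add]
    ring
  rw [h, hq.1, hq.2, hr.1, hr.2, hs.1, hs.2, Real.cos_add, Real.cos_add, Real.sin_add]
  ring

/-- Measurements in the convex hull of the polygon inherit the local model. -/
lemma HasModel.plane {v : ℝ} (h : HasModel fun x y z : Fin 16 =>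
    v * Real.cos (angle x + angle y + angle z)) {X : Type} (θ : X → ℝ) :
    HasModel fun x y z : X =>
      Real.cos (Real.pi / 32) ^ 3 * v * Real.cos (θ x + θ y + θ z) := by
  choose q hq hq1 hq2 using fun x => exists_polygon_combination (θ x)
  obtain ⟨Λ, _, μ, E, F, G, hμ, mE, mF, mG, bE, bF, bG, hE, hF, hG, hEF, hEG, hFG, hT⟩ := h
  have iE := fun x => integrable_of_abs_le_one (μ := μ) (mE x) (bE x)
  have iF := fun x => integrable_of_abs_le_one (μ := μ) (mF x) (bF x)
  have iG := fun x => integrable_of_abs_le_one (μ := μ) (mG x) (bG x)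
  have iEF := fun x y => integrable_of_abs_le_one (μ := μ) ((mE x).mul (mF y))
    fun l => abs_mul_le_one (bE x l) (bF y l)
  have iEG := fun x z => integrable_of_abs_le_one (μ := μ) ((mE x).mul (mG z))
    fun l => abs_mul_le_one (bE x l) (bG z l)
  have iFG := fun y z => integrable_of_abs_le_one (μ := μ) ((mF y).mul (mG z))
    fun l => abs_mul_le_one (bF y l) (bG z l)
  have iEFG : ∀ x y z, Integrable (fun l => E x l * F y l * G z l) μ := fun x y z => integrable_of_abs_le_one (μ := μ) (((mE x).mul (mF y)).mul (mG z))
    fun l => abs_mul_le_one (abs_mul_le_one (bE x l) (bF y l)) (bG z l)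
  have meas : ∀ E : Fin 16 → Λ → ℝ, (∀ x, Measurable (E x)) → ∀ x,
      Measurable fun l => ∑ i, q x i * E i l := fun E mE x =>
    Finset.measurable_fun_sum _ fun i _ => (mE i).const_mul _
  have bound : ∀ E : Fin 16 → Λ → ℝ, (∀ x l, |E x l| ≤ 1) → ∀ x l,
      |∑ i, q x i * E i l| ≤ 1 := fun E bE x l => by
    refine (Finset.abs_sum_le_sum_abs _ _).trans ((Finset.sum_le_sum fun i _ => ?_).trans (hq x))
    rw [abs_mul]
    exact mul_le_of_le_one_right (abs_nonneg _) (bE i l)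
  have one : ∀ E : Fin 16 → Λ → ℝ, (∀ i, Integrable (E i) μ) → (∀ i, ∫ l, E i l ∂μ = 0) →
      ∀ x, ∫ l, ∑ i, q x i * E i l ∂μ = 0 := fun E iE hE x => by
    rw [integral_finsetSum _ fun i _ => (iE i).const_mul _]
    simp [integral_const_mul, hE]
  have two : ∀ E F : Fin 16 → Λ → ℝ, (∀ i j, Integrable (fun l => E i l * F j l) μ) →
      (∀ i j, ∫ l, E i l * F j l ∂μ = 0) →
      ∀ x y, ∫ l, (∑ i, q x i * E i l) * (∑ j, q y j * F j l) ∂μ = 0 := fun E F iEF hEF x y => by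
    have expand : ∀ l, (∑ i, q x i * E i l) * (∑ j, q y j * F j l) =
        ∑ i, ∑ j, q x i * q y j * (E i l * F j l) := fun l => by
      rw [Finset.sum_mul_sum]
      exact Finset.sum_congr rfl fun i _ => Finset.sum_congr rfl fun j _ => by ring
    rw [integral_congr_ae (ae_of_all _ expand), integral_finsetSum _ fun i _ =>
      integrable_finsetSum _ fun j _ => (iEF i j).const_mul _]
    refine Finset.sum_eq_zero fun i _ => ?_
    rw [integral_finsetSum _ fun j _ => (iEF i j).const_mul _]
    simp [integral_const_mul, hEF]
  refine ⟨Λ, _, μ, _, _, _, hμ, meas E mE, meas F mF, meas G mG, bound E bE, bound F bF,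
    bound G bG, one E iE hE, one F iF hF, one G iG hG, two E F iEF hEF, two E G iEG hEG,
    two F G iFG hFG, fun x y z => ?_⟩
  have expand : ∀ l, (∑ i, q x i * E i l) * (∑ j, q y j * F j l) * (∑ k, q z k * G k l) =
      ∑ i, ∑ j, ∑ k, q x i * q y j * q z k * (E i l * F j l * G k l) := fun l => by
    rw [sum_mul_sum_mul_sum]
    exact Finset.sum_congr rfl fun i _ => Finset.sum_congr rfl fun j _ =>
      Finset.sum_congr rfl fun k _ => by ring
  rw [integral_congr_ae (ae_of_all _ expand), integral_finsetSum _ fun i _ =>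
    integrable_finsetSum _ fun j _ => integrable_finsetSum _ fun k _ => (iEFG i j k).const_mul _]
  have tri := sum_cos_trilinear (q x) (q y) (q z) (fun i : Fin 16 => angle i)
    (Real.cos (Real.pi / 32)) (θ x) (θ y) (θ z) ⟨hq1 x, hq2 x⟩ ⟨hq1 y, hq2 y⟩ ⟨hq1 z, hq2 z⟩
  beta_reduce
  rw [mul_right_comm, ← tri, Finset.sum_mul]
  refine Finset.sum_congr rfl fun i _ => ?_
  rw [integral_finsetSum _ fun j _ => integrable_finsetSum _ fun k _ => (iEFG i j k).const_mul _,
    Finset.sum_mul]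
  refine Finset.sum_congr rfl fun j _ => ?_
  rw [integral_finsetSum _ fun k _ => (iEFG i j k).const_mul _, Finset.sum_mul]
  refine Finset.sum_congr rfl fun k _ => ?_
  rw [integral_const_mul, hT]
  ring

/-! ### The cosines of the polygon and the value of the threshold -/

lemma cos_angle_sub (s t : ℕ) (h : s + t = 16) :
    Real.cos (angle s) = -Real.cos (angle t) := by
  have : angle s = Real.pi - angle t := by
    have h' : (s : ℝ) + t = 16 := by exact_mod_cast h
    unfold angle
    linear_combination (Real.pi / 16) * h'
  rw [this, Real.cos_pi_sub]

lemma cos_angle_zero : Real.cos (angle 0) = 1 := by simp [angle]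

lemma cos_angle_eight : Real.cos (angle 8) = 0 := by
  rw [← Real.cos_pi_div_two]
  unfold angle
  congr 1
  push_cast
  ring

lemma cos_angle_sq (s : ℕ) : Real.cos (angle s) ^ 2 = (1 + Real.cos (angle (2 * s))) / 2 := by
  rw [Real.cos_sq, show angle (2 * s) = 2 * angle s by unfold angle; push_cast; ring]
  ring

lemma cos_angle_nonneg (s : ℕ) (h : s ≤ 8) : 0 ≤ Real.cos (angle s) := by
  have hs : (s : ℝ) ≤ 8 := by exact_mod_cast h
  have hπ := Real.pi_pos
  apply Real.cos_nonneg_of_mem_Icc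
  unfold angle
  constructor
  · linarith [show 0 ≤ (s : ℝ) * Real.pi / 16 by positivity]
  · nlinarith

/-- Passes rational bounds through the half-angle formula. Starting from `cos (π / 2) = 0`, it
yields all the cosines needed. -/
lemma sqrt_bounds {c d a b l h : ℝ} (hc : 0 ≤ c) (hcd : c ^ 2 = (1 + d) / 2) (ha : a ≤ d)
    (hb : d ≤ b) (hl : 2 * l ^ 2 - 1 ≤ a) (hh : b ≤ 2 * h ^ 2 - 1) (hh0 : 0 ≤ h) :
    l ≤ c ∧ c ≤ h :=
  ⟨(abs_le_of_sq_le_sq' (by linarith) hc).2, (abs_le_of_sq_le_sq' (by linarith) hh0).2⟩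

lemma cos_four_bounds : 0.70710678118653 ≤ Real.cos (angle 4) ∧
    Real.cos (angle 4) ≤ 0.70710678118656 := by
  refine sqrt_bounds (cos_angle_nonneg 4 (by norm_num)) (cos_angle_sq 4)
    cos_angle_eight.ge cos_angle_eight.le ?_ ?_ ?_ <;> norm_num

lemma cos_two_bounds : 0.9238795325111 ≤ Real.cos (angle 2) ∧
    Real.cos (angle 2) ≤ 0.9238795325114 := by
  refine sqrt_bounds (cos_angle_nonneg 2 (by norm_num)) (cos_angle_sq 2)
    cos_four_bounds.1 cos_four_bounds.2 ?_ ?_ ?_ <;> norm_num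

lemma cos_six_bounds : 0.3826834323649 ≤ Real.cos (angle 6) ∧
    Real.cos (angle 6) ≤ 0.3826834323652 := by
  have h := cos_angle_sub 12 4 rfl
  refine sqrt_bounds (a := -0.70710678118656) (b := -0.70710678118653)
    (cos_angle_nonneg 6 (by norm_num)) (cos_angle_sq 6)
    (by linarith [cos_four_bounds.2]) (by linarith [cos_four_bounds.1]) ?_ ?_ ?_ <;> norm_num

lemma cos_one_bounds : 0.980785280402 ≤ Real.cos (angle 1) ∧
    Real.cos (angle 1) ≤ 0.980785280404 := by
  refine sqrt_bounds (cos_angle_nonneg 1 (by norm_num)) (cos_angle_sq 1)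
    cos_two_bounds.1 cos_two_bounds.2 ?_ ?_ ?_ <;> norm_num

lemma cos_seven_bounds : 0.195090322015 ≤ Real.cos (angle 7) ∧
    Real.cos (angle 7) ≤ 0.195090322017 := by
  have h := cos_angle_sub 14 2 rfl
  refine sqrt_bounds (a := -0.9238795325114) (b := -0.9238795325111)
    (cos_angle_nonneg 7 (by norm_num)) (cos_angle_sq 7)
    (by linarith [cos_two_bounds.2]) (by linarith [cos_two_bounds.1]) ?_ ?_ ?_ <;> norm_num

lemma cos_three_bounds : 0.831469612301 ≤ Real.cos (angle 3) ∧
    Real.cos (angle 3) ≤ 0.831469612304 := by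
  refine sqrt_bounds (cos_angle_nonneg 3 (by norm_num)) (cos_angle_sq 3)
    cos_six_bounds.1 cos_six_bounds.2 ?_ ?_ ?_ <;> norm_num

lemma cos_five_bounds : 0.555570233018 ≤ Real.cos (angle 5) ∧
    Real.cos (angle 5) ≤ 0.555570233021 := by
  have h := cos_angle_sub 10 6 rfl
  refine sqrt_bounds (a := -0.3826834323652) (b := -0.3826834323649)
    (cos_angle_nonneg 5 (by norm_num)) (cos_angle_sq 5)
    (by linarith [cos_six_bounds.2]) (by linarith [cos_six_bounds.1]) ?_ ?_ ?_ <;> norm_num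

lemma cos_pi_div_thirty_two_bounds : 0.99518472666 ≤ Real.cos (Real.pi / 32) ∧
    Real.cos (Real.pi / 32) ≤ 0.99518472668 := by
  have hπ := Real.pi_pos
  refine sqrt_bounds (Real.cos_nonneg_of_mem_Icc ⟨by linarith, by linarith⟩)
    (d := Real.cos (angle 1)) ?_ cos_one_bounds.1 cos_one_bounds.2 ?_ ?_ ?_
  · rw [Real.cos_sq, show angle 1 = 2 * (Real.pi / 32) by unfold angle; push_cast; ring]
    ring
  all_goals norm_num

/-! ### The inverse threshold, the dual value and the weights -/

/-- The inverse of the threshold. -/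
def invThreshold : ℝ :=
  1 / 2 + Real.sqrt 2 / 3
    - (120 * Real.cos (Real.pi / 8) + 56 * Real.sin (Real.pi / 8)) / 137
    + (11960704 * Real.cos (Real.pi / 16) - 11459008 * Real.sin (Real.pi / 16)) / 9508049
    + (15419776 * Real.cos (3 * Real.pi / 16) - 5453760 * Real.sin (3 * Real.pi / 16)) / 9508049

lemma invThreshold_eq : invThreshold = 1 / 2 + 2 * Real.cos (angle 4) / 3
    - (120 * Real.cos (angle 2) + 56 * Real.cos (angle 6)) / 137
    + (11960704 * Real.cos (angle 1) - 11459008 * Real.cos (angle 7)) / 9508049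
    + (15419776 * Real.cos (angle 3) - 5453760 * Real.cos (angle 5)) / 9508049 := by
  have h1 : angle 1 = Real.pi / 16 := by unfold angle; push_cast; ring
  have h2 : angle 2 = Real.pi / 8 := by unfold angle; push_cast; ring
  have h3 : angle 3 = 3 * Real.pi / 16 := by unfold angle; push_cast; ring
  have h4 : angle 4 = Real.pi / 4 := by unfold angle; push_cast; ring
  have h5 : angle 5 = Real.pi / 2 - 3 * Real.pi / 16 := by unfold angle; push_cast; ring
  have h6 : angle 6 = Real.pi / 2 - Real.pi / 8 := by unfold angle; push_cast; ring
  have h7 : angle 7 = Real.pi / 2 - Real.pi / 16 := by unfold angle; push_cast; ring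
  rw [h1, h2, h3, h4, h5, h6, h7, Real.cos_pi_div_two_sub, Real.cos_pi_div_two_sub,
    Real.cos_pi_div_two_sub, Real.cos_pi_div_four, invThreshold]
  ring

lemma invThreshold_bounds : 2.034177 ≤ invThreshold ∧ invThreshold ≤ 2.034179 := by
  rw [invThreshold_eq]
  constructor <;>
    linarith [cos_one_bounds.1, cos_one_bounds.2, cos_two_bounds.1, cos_two_bounds.2,
      cos_three_bounds.1, cos_three_bounds.2, cos_four_bounds.1, cos_four_bounds.2,
      cos_five_bounds.1, cos_five_bounds.2, cos_six_bounds.1, cos_six_bounds.2,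
      cos_seven_bounds.1, cos_seven_bounds.2]

lemma sum_bell_cos : ∑ s ∈ Finset.range 16, (bell s : ℝ) * Real.cos (angle s) =
    7815616278 * invThreshold := by
  have hb : ∀ s < 16, bell ((s : ℕ) : ZMod 32) = ([3907808139, 4915849344, -3422897640, 6337527936,
      2605205426, -2241495360, -1597352232, -4709652288, 0, 4709652288, 1597352232, 2241495360,
      -2605205426, -6337527936, 3422897640, -4915849344] : List ℤ).getD s 0 := by decide
  rw [Finset.sum_congr rfl fun s hs => by rw [hb s (Finset.mem_range.1 hs)]]
  simp only [Finset.sum_range_succ, Finset.sum_range_zero, cos_angle_sub 9 7 rfl,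
    cos_angle_sub 10 6 rfl, cos_angle_sub 11 5 rfl, cos_angle_sub 12 4 rfl, cos_angle_sub 13 3 rfl,
    cos_angle_sub 14 2 rfl, cos_angle_sub 15 1 rfl, cos_angle_eight, cos_angle_zero,
    invThreshold_eq]
  simp
  ring

/-- The inverse of the matrix of the correlations `waveCorr`, scaled by `12 * 137 * 9508049`. -/
def inverseCorr : Fin 8 → Fin 8 → ℤ :=
  ![![3907808139, 7326347904, 6845795280, 6575947392, 5210410852, 4070596608, 3194704464,
      1227239424],
    ![3907808139, 6575947392, 3194704464, -1227239424, -5210410852, -7326347904, -6845795280,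
      -4070596608],
    ![3907808139, 4070596608, -3194704464, -7326347904, -5210410852, 1227239424, 6845795280,
      6575947392],
    ![3907808139, 1227239424, -6845795280, -4070596608, 5210410852, 6575947392, -3194704464,
      -7326347904],
    ![3907808139, -1227239424, -6845795280, 4070596608, 5210410852, -6575947392, -3194704464,
      7326347904],
    ![3907808139, -4070596608, -3194704464, 7326347904, -5210410852, -1227239424, 6845795280,
      -6575947392],
    ![3907808139, -6575947392, 3194704464, 1227239424, -5210410852, 7326347904, -6845795280,
      4070596608],
    ![3907808139, -7326347904, 6845795280, -6575947392, 5210410852, -4070596608, 3194704464,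
      -1227239424]]

/-- An even antiperiodic function is determined by its values at `0, …, 7`, vanishes at `8`, and
satisfies `f (16 - s) = -f s`; this accounts for the three cases. The constant is `1024 * 12 * 137 *
9508049`. -/
lemma sum_inverseCorr_mul : ∀ (n : Fin 16) (s : Fin 8),
    ∑ i, inverseCorr i s * waveCorr (multiplier i * (n : ℕ)) =
      if (n : ℕ) = s then 16006382137344 else if (n : ℕ) + s = 16 then -16006382137344 else 0 := by
  decide +kernel

/-- The weights of the optimal local model, scaled by `invThreshold`. -/
def weight (i : Fin 8) : ℝ := (∑ s : Fin 8, inverseCorr i s * Real.cos (angle s)) / 15631232556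

lemma sum_weight_mul_waveCorr (n : ℕ) :
    ∑ i, weight i * (waveCorr (multiplier i * n) / 1024 : ℝ) = Real.cos (angle n) := by
  induction n using Nat.strong_induction_on with
  | _ n ih =>
    rcases lt_or_ge n 16 with hn | hn
    · have h : ∑ i, weight i * (waveCorr (multiplier i * n) / 1024 : ℝ) =
          (∑ s : Fin 8, Real.cos (angle s) *
            ((∑ i, inverseCorr i s * waveCorr (multiplier i * n) : ℤ) : ℝ)) / 16006382137344 := by
        simp only [weight, Int.cast_sum, Int.cast_mul, Finset.mul_sum, Finset.sum_mul,
          Finset.sum_div]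
        rw [Finset.sum_comm]
        exact Finset.sum_congr rfl fun s _ => Finset.sum_congr rfl fun i _ => by ring
      rw [h, Finset.sum_congr rfl fun s _ => by rw [sum_inverseCorr_mul ⟨n, hn⟩ s]]
      interval_cases n <;>
        simp [Fin.sum_univ_eight, cos_angle_sub 9 7 rfl, cos_angle_sub 10 6 rfl,
          cos_angle_sub 11 5 rfl, cos_angle_sub 12 4 rfl, cos_angle_sub 13 3 rfl,
          cos_angle_sub 14 2 rfl, cos_angle_sub 15 1 rfl, cos_angle_eight, neg_div]
    · obtain ⟨m, rfl⟩ := Nat.exists_eq_add_of_le' hn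
      have hw : ∀ s, waveCorr (s + 16) = -waveCorr s := by decide
      have hm := ih m (by omega)
      rw [show angle (m + 16) = angle m + Real.pi by unfold angle; push_cast; ring,
        Real.cos_add_pi, ← hm, ← Finset.sum_neg_distrib]
      refine Finset.sum_congr rfl fun i _ => ?_
      push_cast
      rw [mul_add, mul_comm _ 16, mul_multiplier, hw]
      push_cast
      ring

lemma sum_abs_weight : ∑ i, |weight i| = invThreshold := by
  have h1 := cos_one_bounds
  have h2 := cos_two_bounds
  have h3 := cos_three_bounds
  have h4 := cos_four_bounds
  have h5 := cos_five_bounds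
  have h6 := cos_six_bounds
  have h7 := cos_seven_bounds
  rw [Fin.sum_univ_eight, invThreshold_eq]
  have e : ∀ i, weight i = (inverseCorr i 0 * 1 + inverseCorr i 1 * Real.cos (angle 1) +
      inverseCorr i 2 * Real.cos (angle 2) + inverseCorr i 3 * Real.cos (angle 3) +
      inverseCorr i 4 * Real.cos (angle 4) + inverseCorr i 5 * Real.cos (angle 5) +
      inverseCorr i 6 * Real.cos (angle 6) + inverseCorr i 7 * Real.cos (angle 7)) /
        15631232556 := fun i => by
    rw [weight, Fin.sum_univ_eight, ← cos_angle_zero]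
    rfl
  simp only [e]
  simp [inverseCorr]
  -- The weights of the multipliers 5, 13 and 15 are the negative ones; `bell` is built from the
  -- same sign pattern.
  rw [abs_of_nonneg, abs_of_nonneg, abs_of_nonpos, abs_of_nonneg, abs_of_nonneg, abs_of_nonneg,
    abs_of_nonpos, abs_of_nonpos]
  · ring
  all_goals
    first
    | apply div_nonneg
    | apply div_nonpos_of_nonpos_of_nonneg
  all_goals linarith

lemma hasModel_polygon : HasModel fun x y z : Fin 16 =>
    invThreshold⁻¹ * Real.cos (angle x + angle y + angle z) := by
  have h0 : 0 < invThreshold := by linarith [invThreshold_bounds.1]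
  have h := hasModel_of_weights (fun i => invThreshold⁻¹ * weight i) (by
    simp only [abs_mul, ← Finset.mul_sum, sum_abs_weight, abs_of_pos (inv_pos.2 h0)]
    exact inv_mul_cancel₀ h0.ne')
  convert h using 4 with x y z
  have := sum_weight_mul_waveCorr (x + y + z)
  rw [show angle x + angle y + angle z = angle (x + y + z) by unfold angle; push_cast; ring,
    ← this, Finset.mul_sum]
  push_cast
  simp only [mul_assoc]

/-! ### The two thresholds -/

lemma polygon_eq : polygon 16 = fun x : Fin 16 => planar (angle x) := by
  funext x
  simp [polygon, planar, angle]

lemma isGreatest_visibility :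
    IsGreatest {v : ℝ | 0 ≤ v ∧ v ≤ 1 ∧ IsLocal (ghzBehaviour (polygon 16) v)}
      invThreshold⁻¹ := by
  have h0 : 0 < invThreshold := by linarith [invThreshold_bounds.1]
  constructor
  · refine ⟨(inv_pos.2 h0).le, inv_le_one_of_one_le₀ (by linarith [invThreshold_bounds.1]), ?_⟩
    rw [polygon_eq]
    exact hasModel_polygon.isLocal
  · rintro v ⟨-, -, hv⟩
    rw [polygon_eq] at hv
    have h := hv.hasModel.le
    -- Since `256 * 7815616278 = 2000797767168`, the Bell inequality becomes `v * invThreshold ≤ 1`,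
    -- matching the model exactly.
    rw [sum_bell_cos] at h
    rw [← one_div, le_div_iff₀ h0]
    linarith

lemma v16_eq : v16 = invThreshold⁻¹ := isGreatest_visibility.csSup_eq

lemma exists_planeXY_eq : ∃ θ : {u : EuclideanSpace ℝ (Fin 3) // ‖u‖ = 1 ∧ u 2 = 0} → ℝ,
    planeXY = fun u => planar (θ u) := by
  refine ⟨fun u => Complex.arg ⟨u.1 0, u.1 1⟩, funext fun u => ?_⟩
  obtain ⟨u, hu, hu2⟩ := u
  have hn : u 0 ^ 2 + u 1 ^ 2 = 1 := by
    have := EuclideanSpace.real_norm_sq_eq u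
    rw [hu, Fin.sum_univ_three, hu2] at this
    linarith
  have hz : ‖(⟨u 0, u 1⟩ : ℂ)‖ = 1 := by
    rw [Complex.norm_def, Complex.normSq_mk, ← sq, ← sq, hn, Real.sqrt_one]
  have h1 := Complex.norm_mul_cos_arg ⟨u 0, u 1⟩
  have h2 := Complex.norm_mul_sin_arg ⟨u 0, u 1⟩
  rw [hz, one_mul] at h1 h2
  ext i
  fin_cases i
  · simp [planeXY, planar, h1]
  · simp [planeXY, planar, h2]
  · simp [planeXY, planar, hu2]

/-- The supremum `v16` is attained, so the optimal polygon model itself can be extended to the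
plane. -/
lemma le_vXY : Real.cos (Real.pi / 32) ^ 3 * v16 ≤ vXY := by
  have hk := cos_pi_div_thirty_two_bounds
  have hk0 : 0 ≤ Real.cos (Real.pi / 32) := by linarith [hk.1]
  have hv := isGreatest_visibility.1
  rw [v16_eq]
  refine le_csSup ⟨1, fun v hv => hv.2.1⟩ ⟨by have := hv.1; positivity, ?_, ?_⟩
  · exact mul_le_one₀ (pow_le_one₀ hk0 (Real.cos_le_one _)) hv.1 hv.2.1
  · obtain ⟨θ, hθ⟩ := exists_planeXY_eq
    rw [hθ]
    exact (hasModel_polygon.plane θ).isLocal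

lemma v16_bounds : 0.491598 ≤ v16 ∧ v16 ≤ 0.4916 := by
  have h0 : 0 < invThreshold := by linarith [invThreshold_bounds.1]
  rw [v16_eq, ← one_div]
  constructor
  · rw [le_div_iff₀ h0]
    linarith [invThreshold_bounds.2]
  · rw [div_le_iff₀ h0]
    linarith [invThreshold_bounds.1]

lemma cos_cube_mul_v16_bounds : 0.48453 ≤ Real.cos (Real.pi / 32) ^ 3 * v16 ∧
    Real.cos (Real.pi / 32) ^ 3 * v16 ≤ 0.484533 := by
  have hk := cos_pi_div_thirty_two_bounds
  have hv := v16_bounds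
  have h1 : (0.99518472666 : ℝ) ^ 3 ≤ Real.cos (Real.pi / 32) ^ 3 :=
    pow_le_pow_left₀ (by norm_num) hk.1 3
  have h2 : Real.cos (Real.pi / 32) ^ 3 ≤ (0.99518472668 : ℝ) ^ 3 :=
    pow_le_pow_left₀ (by linarith [hk.1]) hk.2 3
  constructor
  · refine le_trans ?_ (mul_le_mul h1 hv.1 (by norm_num) (le_trans (by norm_num) h1))
    norm_num
  · refine (mul_le_mul h2 hv.2 (by linarith [hv.1]) (by norm_num)).trans ?_
    norm_num

end GHZ

end

theorem mainTheorem7 :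
    GHZ.v16 =
        (1 / 2 + Real.sqrt 2 / 3
          - (120 * Real.cos (Real.pi / 8) + 56 * Real.sin (Real.pi / 8)) / 137
          + (11960704 * Real.cos (Real.pi / 16) - 11459008 * Real.sin (Real.pi / 16)) / 9508049
          + (15419776 * Real.cos (3 * Real.pi / 16) - 5453760 * Real.sin (3 * Real.pi / 16))
              / 9508049)⁻¹ ∧
      |GHZ.v16 - 0.49160| ≤ 0.000005 ∧
      Real.cos (Real.pi / 32) ^ 3 * GHZ.v16 ≤ GHZ.vXY ∧
      |Real.cos (Real.pi / 32) ^ 3 * GHZ.v16 - 0.48453| ≤ 0.000005 := by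
  have h1 := GHZ.v16_bounds
  have h2 := GHZ.cos_cube_mul_v16_bounds
  exact ⟨GHZ.v16_eq, abs_le.2 ⟨by linarith, by linarith⟩, GHZ.le_vXY,
    abs_le.2 ⟨by linarith, by linarith⟩⟩
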